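/- Let $\mathbb C^6$ have coordinates $l_{ij}=l_{ji}$ indexed by the six pairs $1\le i<j\le 4$. For a configuration $\mathbf p=(\mathbf p_1,\dots,\mathbf p_4)$ of four points in $\mathbb C^d$ put $m_{ij}(\mathbf p)=\sum_{k=1}^d(\mathbf p_i^k-\mathbf p_j^k)^2$ (no conjugation), and let $$L_{d,4}=\{\,l\in\mathbb C^6:\ \text{there is a configuration } \mathbf p \text{ of four points in } \mathbb C^d \text{ with } l_{ij}^2=m_{ij}(\mathbf p)\text{ for all } i<j\,\}.$$ For a complex affine variety $V$, let $\operatorname{sing}(V)$ be the set of points $x\in V$ at which the dimension of the Zariski tangent space (the kernel of the Jacobian matrix at $x$ of generators of the ideal $I(V)$ of all polynomials vanishing on $V$) differs from the local dimension (the largest dimension of an irreducible component of $V$ through $x$). **Theorem.** The singular locus $\operatorname{sing}(L_{2,4})$ is the union of $60$ distinct $3$-dimensional linear subspaces of $\mathbb C^6$, which are partitioned into the following three types. - Type I: $32$ subspaces, whose union is $L_{1,4}$ (they arise from configurations of four points on a line). They are the subspaces defined by $$l_{12}-s_{13}l_{13}+s_{23}l_{23}=0,\qquad l_{12}-s_{14}l_{14}+s_{24}l_{24}=0,\qquad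 s_{13}l_{13}-s_{14}l_{14}+s_{34}l_{34}=0,$$ with $s_{13},s_{23},s_{14},s_{24},s_{34}\in\{-1,1\}$. - Type II: $24$ subspaces, four for each of the six pairs $i<j$. The four subspaces for $ij$ are those defined by $$l_{ij}=0,\qquad l_{ik}-s_{k}\,l_{jk}=0,\qquad l_{ih}-s_{h}\,l_{jh}=0,$$ where $\{i,j,k,h\}=\{1,2,3,4\}$ and $s_k,s_h\in\{-1,1\}$; their union is the set of $l\in\mathbb C^6$ for which there is a configuration $\mathbf p$ of four points in $\mathbb C^2$ with $\mathbf p_i=\mathbf p_j$ and $l_{ab}^2=m_{ab}(\mathbf p)$ for all $a<b$. - Type III: $4$ subspaces, one for each triple $i<j<k$, defined by $l_{ij}=l_{ik}=l_{jk}=0$. -/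

import Mathlib

noncomputable section

/-! ### Affine varieties in `ℂ^σ`, dimension, singular locus -/

section Varieties

variable {σ : Type*}

/-- A (complex, embedded, affine) variety: the common zero set of finitely many polynomials. -/
def IsVariety (V : Set (σ → ℂ)) : Prop :=
  ∃ S : Finset (MvPolynomial σ ℂ), V = {x | ∀ p ∈ S, MvPolynomial.eval x p = 0}

/-- A nonempty variety that is not the union of two varieties neither of which contains
the other. -/
def IsIrreducibleVariety (V : Set (σ → ℂ)) : Prop :=
  IsVariety V ∧ V.Nonempty ∧
    ∀ V₁ V₂ : Set (σ → ℂ), IsVariety V₁ → IsVariety V₂ → V = V₁ ∪ V₂ → V₁ ⊆ V₂ ∨ V₂ ⊆ V₁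

/-- The components of `V`: its maximal irreducible subvarieties. -/
def IsVarietyComponent (V Z : Set (σ → ℂ)) : Prop :=
  Maximal (fun W => IsIrreducibleVariety W ∧ W ⊆ V) Z

/-- The dimension of a variety: the Krull dimension of its coordinate ring `ℂ[x] / I(V)`. -/
def varietyDim (V : Set (σ → ℂ)) : WithBot ℕ∞ :=
  ringKrullDim (MvPolynomial σ ℂ ⧸ MvPolynomial.vanishingIdeal ℂ V)

/-- The local dimension of `V` at `x`: the largest dimension of a component of `V` through `x`. -/
def localDim (V : Set (σ → ℂ)) (x : σ → ℂ) : WithBot ℕ∞ :=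
  ⨆ Z ∈ {Z : Set (σ → ℂ) | IsVarietyComponent V Z ∧ x ∈ Z}, varietyDim Z

variable [Fintype σ]

/-- The Zariski tangent space of `V` at `x`: the vectors annihilated by the gradients at `x` of
all polynomials in `I(V)`. (For `x ∈ V` this is the kernel of the Jacobian matrix at `x` of any
generating set of `I(V)`.) -/
def zariskiTangentSpace (V : Set (σ → ℂ)) (x : σ → ℂ) : Submodule ℂ (σ → ℂ) where
  carrier := {v | ∀ p ∈ MvPolynomial.vanishingIdeal ℂ V,
    ∑ i, MvPolynomial.eval x (MvPolynomial.pderiv i p) * v i = 0}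
  zero_mem' := by intro p _; simp
  add_mem' := by
    intro v w hv hw p hp
    simp only [Pi.add_apply, mul_add, Finset.sum_add_distrib, hv p hp, hw p hp, add_zero]
  smul_mem' := by
    intro c v hv p hp
    have h := hv p hp
    simp only [Pi.smul_apply, smul_eq_mul, mul_left_comm _ c, ← Finset.mul_sum, h, mul_zero]

/-- The singular locus of `V`: the points of `V` at which the dimension of the Zariski tangent
space differs from the local dimension. -/
def singularLocus (V : Set (σ → ℂ)) : Set (σ → ℂ) :=
  {x | x ∈ V ∧ (Module.finrank ℂ (zariskiTangentSpace V x) : WithBot ℕ∞) ≠ localDim V x}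

end Varieties

/-! ### Measurement varieties -/

/-- The edges `ij`, `i < j`, of the complete graph on `n` vertices. -/
abbrev Edge (n : ℕ) : Type := {e : Fin n × Fin n // e.1 < e.2}

/-- The vector of complex squared lengths `m_{ij}(p) = ∑ₖ (pᵢᵏ - pⱼᵏ)²` (no conjugation) of a
configuration `p` of `n` points in `ℂ^d`. -/
def sqLengths {d n : ℕ} (p : Fin n → Fin d → ℂ) : Edge n → ℂ :=
  fun e => ∑ k, (p e.1.1 k - p e.1.2 k) ^ 2

/-- The squared measurement variety `M_{d,n}`. -/
def squaredMeasurementVariety (d n : ℕ) : Set (Edge n → ℂ) :=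
  Set.range (sqLengths (d := d) (n := n))

/-- The squaring map, acting coordinatewise. -/
def squaringMap {n : ℕ} (l : Edge n → ℂ) : Edge n → ℂ := fun e => l e ^ 2

/-- The unsquared measurement variety `L_{d,n}`. -/
def unsquaredMeasurementVariety (d n : ℕ) : Set (Edge n → ℂ) :=
  squaringMap ⁻¹' squaredMeasurementVariety d n

/-- The coordinate `l_{ij} = l_{ji}` of `l` at the unordered pair of distinct vertices `i, j`
(and `0` if `i = j`), as a linear functional of `l`. -/
def len {n : ℕ} (i j : Fin n) : (Edge n → ℂ) →ₗ[ℂ] ℂ :=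
  if h : i < j then LinearMap.proj (⟨(i, j), h⟩ : Edge n)
  else if h : j < i then LinearMap.proj (⟨(j, i), h⟩ : Edge n)
  else 0

/-! ### The three types of subspaces of `ℂ^6`

The vertices `1, 2, 3, 4` are written `0, 1, 2, 3 : Fin 4`. Signs are elements of `ℤˣ = {1, -1}`.
-/

/-- The subspace `l₁₂ - s₁₃ l₁₃ + s₂₃ l₂₃ = 0`, `l₁₂ - s₁₄ l₁₄ + s₂₄ l₂₄ = 0`,
`s₁₃ l₁₃ - s₁₄ l₁₄ + s₃₄ l₃₄ = 0`. -/
def subspaceI (s₁₃ s₂₃ s₁₄ s₂₄ s₃₄ : ℤˣ) : Submodule ℂ (Edge 4 → ℂ) :=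
  LinearMap.ker (len 0 1 - s₁₃ • len 0 2 + s₂₃ • len 1 2) ⊓
  LinearMap.ker (len 0 1 - s₁₄ • len 0 3 + s₂₄ • len 1 3) ⊓
  LinearMap.ker (s₁₃ • len 0 2 - s₁₄ • len 0 3 + s₃₄ • len 2 3)

/-- The subspaces of type I. -/
def typeI : Set (Submodule ℂ (Edge 4 → ℂ)) :=
  {W | ∃ s₁₃ s₂₃ s₁₄ s₂₄ s₃₄ : ℤˣ, W = subspaceI s₁₃ s₂₃ s₁₄ s₂₄ s₃₄}

/-- The subspace `l_{ij} = 0`, `l_{ik} = sₖ l_{jk}` for the two vertices `k` other than `i, j`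
(the values of `s` at `i` and `j` are not used). -/
def subspaceII (i j : Fin 4) (s : Fin 4 → ℤˣ) : Submodule ℂ (Edge 4 → ℂ) :=
  LinearMap.ker (len i j) ⊓
  ⨅ k ∈ {k : Fin 4 | k ≠ i ∧ k ≠ j}, LinearMap.ker (len i k - s k • len j k)

/-- The subspaces of type II coming from collapsing the edge `ij`. -/
def typeIIAt (i j : Fin 4) : Set (Submodule ℂ (Edge 4 → ℂ)) :=
  {W | ∃ s : Fin 4 → ℤˣ, W = subspaceII i j s}

/-- The subspaces of type II. -/
def typeII : Set (Submodule ℂ (Edge 4 → ℂ)) :=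
  {W | ∃ i j : Fin 4, i < j ∧ W ∈ typeIIAt i j}

/-- The subspace `l_{ij} = l_{ik} = l_{jk} = 0`. -/
def subspaceIII (i j k : Fin 4) : Submodule ℂ (Edge 4 → ℂ) :=
  LinearMap.ker (len i j) ⊓ LinearMap.ker (len i k) ⊓ LinearMap.ker (len j k)

/-- The subspaces of type III. -/
def typeIII : Set (Submodule ℂ (Edge 4 → ℂ)) :=
  {W | ∃ i j k : Fin 4, i < j ∧ j < k ∧ W = subspaceIII i j k}

end

/-! ### Irreducible hypersurfaces: ideal, dimension, Jacobian criterion. -/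

section Hypersurface

open MvPolynomial

/-! The Gram matrix of p₁-p₀, p₂-p₀, p₃-p₀ is determined by the squared lengths, and over ℂ every
singular symmetric 3 × 3 matrix is the Gram matrix of three vectors of ℂ² (`exists_gram_three`). So
L_{2,4} is the zero set of the Cayley–Menger polynomial F in the lengths, and L_{1,4} is the locus
where all 2 × 2 cofactors vanish. F is irreducible (`irreducible_cayleyMengerPoly`), hence generates
the ideal of L_{2,4}, and the singular points are the common zeros of F and its gradient
(`singularLocus_hypersurface`).

By the chain rule ∂F/∂l_ij = 2 l_ij D_ij, where D_ij is the partial derivative in l_ij². On L_{1,4}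
every D_ij vanishes. Elsewhere on L_{2,4} the Gram matrix has rank two and its adjugate rank one, so
D_ij is proportional to wᵢ wⱼ for an affine dependency w of the four points
(`exists_affine_dependency`). The gradient then vanishes iff l_ij wᵢ wⱼ = 0 for every edge. As w is
nonzero with sum zero, it has at least two nonzero entries. Exactly two give vertices i, j with l_ij
= 0 and equal squared lengths to the other vertices (type II); three or more give a triangle of zero
lengths (type III). This is `mem_typeII_or_typeIII_of_affine_dependency`.

The subspaces are told apart by exhibiting a sufficiently generic point on each type I and type II
subspace, and a separating point on each type III subspace. -/

lemma add_one_cancel_withBot_enat {a : WithBot ℕ∞} {n : ℕ} (h : a + 1 = (n : WithBot ℕ∞) + 1) :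
    a = n := by
  cases a with
  | bot => exact absurd h.symm (by rw [WithBot.bot_add]; norm_cast)
  | coe a =>
    cases a with
    | top => exact absurd h.symm (by norm_cast; simp)
    | coe a => norm_cast at h ⊢; omega

variable {σ : Type*} {V : Set (σ → ℂ)} {f : MvPolynomial σ ℂ}

/-- The automorphism `X i ↦ X i + c i` of a polynomial ring. -/
noncomputable def translateEquiv (c : σ → ℂ) : MvPolynomial σ ℂ ≃ₐ[ℂ] MvPolynomial σ ℂ :=
  AlgEquiv.ofAlgHom (aeval fun i => X i + C (c i)) (aeval fun i => X i - C (c i))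
    (by ext i : 1; simp [algHom_C]) (by ext i : 1; simp [algHom_C])

lemma aeval_translateEquiv (c x : σ → ℂ) (p : MvPolynomial σ ℂ) :
    aeval x (translateEquiv c p) = aeval (x + c) p := by
  have : (aeval x).comp (translateEquiv c : MvPolynomial σ ℂ →ₐ[ℂ] MvPolynomial σ ℂ)
      = aeval (R := ℂ) (x + c) := by
    ext i
    simp [translateEquiv]
  exact DFunLike.congr_fun this p

lemma zeroLocus_span_singleton (f : MvPolynomial σ ℂ) :
    zeroLocus ℂ (Ideal.span {f}) = {x | eval x f = 0} := by
  rw [zeroLocus_span]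
  ext x
  simp [aeval_eq_eval]

lemma isVariety_hypersurface (f : MvPolynomial σ ℂ) : IsVariety {x | eval x f = 0} :=
  ⟨{f}, by simp⟩

lemma isVarietyComponent_iff_of_isIrreducibleVariety (hV : IsIrreducibleVariety V)
    {Z : Set (σ → ℂ)} : IsVarietyComponent V Z ↔ Z = V := by
  constructor
  · intro h
    exact subset_antisymm h.1.2 (h.2 ⟨hV, subset_rfl⟩ h.1.2)
  · rintro rfl
    exact ⟨⟨hV, subset_rfl⟩, fun W hW _ => hW.2⟩

lemma localDim_of_isIrreducibleVariety (hV : IsIrreducibleVariety V) {x : σ → ℂ} (hx : x ∈ V) :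
    localDim V x = varietyDim V := by
  apply le_antisymm
  · refine iSup₂_le fun Z hZ => ?_
    rw [(isVarietyComponent_iff_of_isIrreducibleVariety hV).1 hZ.1]
  · exact le_iSup₂_of_le (f := fun Z
      (_ : Z ∈ {Z : Set (σ → ℂ) | IsVarietyComponent V Z ∧ x ∈ Z}) => varietyDim Z) V
      ⟨(isVarietyComponent_iff_of_isIrreducibleVariety hV).2 rfl, hx⟩ le_rfl

/-- The maximal ideals of two points have the same height. -/
lemma height_vanishingIdeal_singleton_eq (a b : σ → ℂ) :
    (vanishingIdeal ℂ {a}).height = (vanishingIdeal ℂ {b}).height := by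
  rw [← RingEquiv.height_comap (translateEquiv (a - b)).toRingEquiv (vanishingIdeal ℂ {b})]
  congr 1
  ext p
  have h := aeval_translateEquiv (a - b) b p
  rw [add_sub_cancel] at h
  rw [Ideal.mem_comap, mem_vanishingIdeal_singleton_iff, mem_vanishingIdeal_singleton_iff, ← h]
  rfl

variable [Fintype σ]

/-- The maximal ideal of a point of affine space has full height. -/
lemma height_vanishingIdeal_singleton (a : σ → ℂ) :
    ((vanishingIdeal ℂ {a}).height : WithBot ℕ∞) = ringKrullDim (MvPolynomial σ ℂ) := by
  rw [← Ideal.sup_isMaximal_height_eq_ringKrullDim, WithBot.coe_inj]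
  apply le_antisymm
  · exact le_iSup₂_of_le (f := fun (I : Ideal (MvPolynomial σ ℂ)) (_ : I.IsMaximal) => I.height)
      (vanishingIdeal ℂ {a}) (isMaximal_iff_eq_vanishingIdeal_singleton.2 ⟨a, rfl⟩) le_rfl
  · refine iSup₂_le fun I hI => ?_
    -- By the Nullstellensatz every maximal ideal is that of a point, and translations make all
    -- their heights equal.
    obtain ⟨b, rfl⟩ := isMaximal_iff_eq_vanishingIdeal_singleton.1 hI
    exact (height_vanishingIdeal_singleton_eq b a).le

/-- The ideal of an irreducible hypersurface is generated by its equation. -/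
lemma vanishingIdeal_hypersurface (hf : Irreducible f) :
    vanishingIdeal ℂ {x | eval x f = 0} = Ideal.span {f} := by
  have : (Ideal.span {f}).IsPrime := (Ideal.span_singleton_prime hf.ne_zero).2 hf.prime
  rw [← zeroLocus_span_singleton, IsPrime.vanishingIdeal_zeroLocus]

lemma nonempty_hypersurface (hf : Irreducible f) : {x | eval x f = 0}.Nonempty := by
  rw [Set.nonempty_iff_ne_empty]
  intro h
  have h2 := vanishingIdeal_hypersurface hf
  rw [h, vanishingIdeal_empty] at h2
  exact hf.not_isUnit (Ideal.span_singleton_eq_top.1 h2.symm)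

/-- If V = V₁ ∪ V₂, a product of an equation of V₁ and one of V₂ vanishes on V, so the prime `f`
divides one of the two factors. Points of V outside V₁ and outside V₂ provide a pair of equations
for which this fails. -/
lemma isIrreducibleVariety_hypersurface (hf : Irreducible f) :
    IsIrreducibleVariety {x | eval x f = 0} := by
  refine ⟨isVariety_hypersurface f, nonempty_hypersurface hf, ?_⟩
  rintro V₁ V₂ ⟨S₁, hS₁⟩ ⟨S₂, hS₂⟩ hV
  by_contra! hcon
  obtain ⟨h₁, h₂⟩ := hcon
  obtain ⟨x, hx₁, hx₂⟩ := Set.not_subset.1 h₁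
  obtain ⟨y, hy₂, hy₁⟩ := Set.not_subset.1 h₂
  have key : ∀ p₁ ∈ S₁, ∀ p₂ ∈ S₂, f ∣ p₁ ∨ f ∣ p₂ := by
    intro p₁ hp₁ p₂ hp₂
    apply hf.prime.dvd_or_dvd
    rw [← Ideal.mem_span_singleton, ← vanishingIdeal_hypersurface hf, mem_vanishingIdeal_iff]
    intro z hz
    rw [hV] at hz
    rw [aeval_eq_eval, map_mul]
    rcases hz with hz | hz
    · rw [hS₁] at hz
      rw [hz p₁ hp₁, zero_mul]
    · rw [hS₂] at hz
      rw [hz p₂ hp₂, mul_zero]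
  have hxV : eval x f = 0 := by
    have : x ∈ {x | eval x f = 0} := hV ▸ Or.inl hx₁
    exact this
  have hyV : eval y f = 0 := by
    have : y ∈ {x | eval x f = 0} := hV ▸ Or.inr hy₂
    exact this
  rw [hS₂] at hx₂
  rw [hS₁] at hy₁
  simp only [Set.mem_ofPred_eq, not_forall] at hx₂ hy₁
  obtain ⟨p₂, hp₂, hx₂⟩ := hx₂
  obtain ⟨p₁, hp₁, hy₁⟩ := hy₁
  rcases key p₁ hp₁ p₂ hp₂ with ⟨q, rfl⟩ | ⟨q, rfl⟩
  · exact hy₁ (by rw [map_mul, hyV, zero_mul])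
  · exact hx₂ (by rw [map_mul, hxV, zero_mul])

/-- Dividing by the nonzerodivisor `f` lowers the dimension by exactly one because `f` lies in the
maximal ideal of a point, which has full height. -/
lemma varietyDim_hypersurface_add_one (hf : Irreducible f) :
    varietyDim {x | eval x f = 0} + 1 = (Fintype.card σ : WithBot ℕ∞) := by
  obtain ⟨a, ha⟩ := nonempty_hypersurface hf
  have : (vanishingIdeal ℂ {a}).IsMaximal :=
    isMaximal_iff_eq_vanishingIdeal_singleton.2 ⟨a, rfl⟩
  have : (vanishingIdeal ℂ {a}).IsPrime := this.isPrime
  rw [varietyDim, vanishingIdeal_hypersurface hf,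
    Module.ringKrullDim_quotient_add_one_of_mem_nonZeroDivisors
      (mem_nonZeroDivisors_of_ne_zero hf.ne_zero) (height_vanishingIdeal_singleton a)
      (by simpa [aeval_eq_eval] using ha)]
  simp

/-- The gradient of a polynomial at a point, as a linear functional. -/
noncomputable def gradientFunctional (f : MvPolynomial σ ℂ) (x : σ → ℂ) : (σ → ℂ) →ₗ[ℂ] ℂ :=
  ∑ i, eval x (pderiv i f) • LinearMap.proj i

lemma gradientFunctional_apply (f : MvPolynomial σ ℂ) (x v : σ → ℂ) :
    gradientFunctional f x v = ∑ i, eval x (pderiv i f) * v i := by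
  simp [gradientFunctional]

lemma zariskiTangentSpace_hypersurface (hf : Irreducible f) {x : σ → ℂ} (hx : eval x f = 0) :
    zariskiTangentSpace {x | eval x f = 0} x = LinearMap.ker (gradientFunctional f x) := by
  ext v
  rw [LinearMap.mem_ker, gradientFunctional_apply]
  change (∀ p ∈ vanishingIdeal ℂ {x | eval x f = 0}, _) ↔ _
  rw [vanishingIdeal_hypersurface hf]
  constructor
  · intro h
    exact h f (Ideal.mem_span_singleton_self f)
  · intro h p hp
    obtain ⟨q, rfl⟩ := Ideal.mem_span_singleton.1 hp
    simp only [pderiv_mul, map_add, map_mul, hx, zero_mul, add_zero]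
    simp only [mul_right_comm _ (eval x q), ← Finset.sum_mul, h, zero_mul]

/-- The Jacobian criterion for irreducible hypersurfaces. -/
theorem singularLocus_hypersurface (hf : Irreducible f) :
    singularLocus {x | eval x f = 0} =
      {x | eval x f = 0 ∧ ∀ i, eval x (pderiv i f) = 0} := by
  classical
  ext x
  refine and_congr_right fun hx => ?_
  change eval x f = 0 at hx
  rw [localDim_of_isIrreducibleVariety (isIrreducibleVariety_hypersurface hf) hx,
    zariskiTangentSpace_hypersurface hf hx]
  have hdim := varietyDim_hypersurface_add_one hf
  have hcard : Module.finrank ℂ (σ → ℂ) = Fintype.card σ := Module.finrank_fintype_fun_eq_card ℂ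
  constructor
  · intro h
    by_contra! hne
    obtain ⟨i, hi⟩ := hne
    apply h
    -- A nonzero functional is onto ℂ, so its kernel has codimension one, which is the dimension of
    -- the hypersurface.
    have hsurj : Function.Surjective (gradientFunctional f x) := by
      apply LinearMap.surjective
      intro h0
      apply hi
      have := gradientFunctional_apply f x (Pi.single i 1)
      simpa [h0, Pi.single_apply] using this.symm
    have hrank := LinearMap.finrank_range_add_finrank_ker (gradientFunctional f x)
    rw [LinearMap.range_eq_top.2 hsurj, finrank_top, Module.finrank_self, hcard] at hrank
    rw [← hrank, Nat.cast_add, Nat.cast_one] at hdim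
    exact (add_one_cancel_withBot_enat (hdim.trans (add_comm _ _))).symm
  · intro h heq
    have h0 : gradientFunctional f x = 0 := by
      ext v
      simp [gradientFunctional_apply, h]
    rw [h0, LinearMap.ker_zero, finrank_top, hcard] at heq
    rw [← heq] at hdim
    norm_cast at hdim
    omega

end Hypersurface

/-! ### The Cayley–Menger polynomial and its irreducibility. -/

section CayleyMenger

/-- Half the determinant of the Gram matrix `(2 uᵢ·uⱼ)` of the vectors `uᵢ = pᵢ - p₀`,
`i = 1, 2, 3`, expressed in the squared lengths `a = m₀₁`, `b = m₀₂`, `c = m₀₃`, `d = m₁₂`,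
`e = m₁₃`, `f = m₂₃`. -/
def cayleyMenger {R : Type*} [CommRing R] (a b c d e f : R) : R :=
  4 * a * b * c + (a + b - d) * (a + c - e) * (b + c - f) - a * (b + c - f) ^ 2
    - b * (a + c - e) ^ 2 - c * (a + b - d) ^ 2

lemma map_cayleyMenger {R S : Type*} [CommRing R] [CommRing S] {F : Type*} [FunLike F R S]
    [RingHomClass F R S] (φ : F) (a b c d e f : R) :
    φ (cayleyMenger a b c d e f) = cayleyMenger (φ a) (φ b) (φ c) (φ d) (φ e) (φ f) := by
  simp only [cayleyMenger, map_add, map_sub, map_mul, map_pow, map_ofNat]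

/-- The edges of the tetrahedron in lexicographic order. -/
def tetrahedronEdge : Fin 6 → Edge 4 :=
  ![⟨(0, 1), by decide⟩, ⟨(0, 2), by decide⟩, ⟨(0, 3), by decide⟩, ⟨(1, 2), by decide⟩,
    ⟨(1, 3), by decide⟩, ⟨(2, 3), by decide⟩]

lemma tetrahedronEdge_bijective : Function.Bijective tetrahedronEdge := by
  decide

open MvPolynomial

/-- The Cayley–Menger polynomial of a tetrahedron in its edge lengths, with numbered edges. -/
noncomputable def cayleyMengerPolyFin : MvPolynomial (Fin 6) ℂ :=
  cayleyMenger (X 0 ^ 2) (X 1 ^ 2) (X 2 ^ 2) (X 3 ^ 2) (X 4 ^ 2) (X 5 ^ 2)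

/-- The Cayley–Menger polynomial of a tetrahedron in its edge lengths. -/
noncomputable def cayleyMengerPoly : MvPolynomial (Edge 4) ℂ :=
  rename tetrahedronEdge cayleyMengerPolyFin

/-- An element of the square of the maximal ideal of a point has vanishing gradient there. -/
lemma eval_pderiv_eq_zero_of_mem_sq {σ : Type*} {x : σ → ℂ} {p : MvPolynomial σ ℂ}
    (hp : p ∈ RingHom.ker (eval x) ^ 2) (i : σ) : eval x (pderiv i p) = 0 := by
  rw [sq] at hp
  induction hp using Submodule.mul_induction_on' with
  | mem_mul_mem a ha b hb =>
    rw [RingHom.mem_ker] at ha hb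
    simp [ha, hb]
  | add a _ b _ ha hb => rw [map_add, map_add, ha, hb, add_zero]

/-- The coefficient of `X₀²` in the Cayley–Menger polynomial. -/
noncomputable def cayleyMengerCoeffTwo : MvPolynomial (Fin 5) ℂ :=
  4 * X 0 ^ 2 * X 1 ^ 2
    + ((X 0 ^ 2 - X 2 ^ 2) + (X 1 ^ 2 - X 3 ^ 2)) * (X 0 ^ 2 + X 1 ^ 2 - X 4 ^ 2)
    - (X 0 ^ 2 + X 1 ^ 2 - X 4 ^ 2) ^ 2
    - 2 * X 0 ^ 2 * (X 1 ^ 2 - X 3 ^ 2) - 2 * X 1 ^ 2 * (X 0 ^ 2 - X 2 ^ 2)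

/-- The constant coefficient with respect to `X₀` of the Cayley–Menger polynomial. -/
noncomputable def cayleyMengerCoeffZero : MvPolynomial (Fin 5) ℂ :=
  cayleyMenger 0 (X 0 ^ 2) (X 1 ^ 2) (X 2 ^ 2) (X 3 ^ 2) (X 4 ^ 2)

lemma finSuccEquiv_cayleyMengerPolyFin :
    finSuccEquiv ℂ 5 cayleyMengerPolyFin =
      Polynomial.C (-X 4 ^ 2) * Polynomial.X ^ 4
        + Polynomial.C cayleyMengerCoeffTwo * Polynomial.X ^ 2
        + Polynomial.C cayleyMengerCoeffZero := by
  have h : ∀ i : Fin 5, finSuccEquiv ℂ 5 (X i.succ) = Polynomial.C (X i) :=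
    fun i => finSuccEquiv_X_succ
  have h1 := h 0
  have h2 := h 1
  have h3 := h 2
  have h4 := h 3
  have h5 := h 4
  simp only [Fin.succ_zero_eq_one, Fin.succ_one_eq_two, Fin.reduceSucc] at h1 h2 h3 h4 h5
  rw [cayleyMengerPolyFin, map_cayleyMenger]
  simp only [map_pow, h1, h2, h3, h4, h5, finSuccEquiv_X_zero]
  simp only [cayleyMengerCoeffTwo, cayleyMengerCoeffZero, cayleyMenger, map_add, map_sub, map_mul,
    map_pow, map_neg, map_zero, map_ofNat]
  ring

/-- Eisenstein's criterion for a quartic in l₀₁ over the polynomial ring in the other five lengths,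
at the maximal ideal of a point: the lower coefficients vanish there, the leading one does not, and
the constant one vanishes only to first order. -/
lemma irreducible_quartic_cayleyMenger :
    Irreducible (Polynomial.C (-X 4 ^ 2 : MvPolynomial (Fin 5) ℂ) * Polynomial.X ^ 4
        + Polynomial.C cayleyMengerCoeffTwo * Polynomial.X ^ 2
        + Polynomial.C cayleyMengerCoeffZero) := by
  set p := Polynomial.C (-X 4 ^ 2 : MvPolynomial (Fin 5) ℂ) * Polynomial.X ^ 4
        + Polynomial.C cayleyMengerCoeffTwo * Polynomial.X ^ 2
        + Polynomial.C cayleyMengerCoeffZero with hp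
  have hdeg : p.natDegree = 4 := by
    rw [hp]; compute_degree!
  have hcoeff (n : ℕ) : p.coeff n = -X 4 ^ 2 * (if n = 4 then 1 else 0)
      + cayleyMengerCoeffTwo * (if n = 2 then 1 else 0)
      + (if n = 0 then cayleyMengerCoeffZero else 0) := by
    simp only [hp, Polynomial.coeff_add, Polynomial.coeff_C_mul, Polynomial.coeff_X_pow,
      Polynomial.coeff_C]
  have hc4 : p.coeff 4 = -X 4 ^ 2 := by simp [hcoeff]
  have hc0 : p.coeff 0 = cayleyMengerCoeffZero := by simp [hcoeff]
  have hp0 : p ≠ 0 := fun h => by simp [h] at hdeg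
  have hlead : p.leadingCoeff = -X 4 ^ 2 := by
    rw [Polynomial.leadingCoeff, hdeg, hc4]
  -- Write b, c, d, e, f for the squares of these coordinates and u = b - d, v = c - e. With b = c
  -- and f = 4b the constant coefficient is -b(u + v)², and the quadratic one is a multiple of u +
  -- v. The squares 1, 25, 49 in arithmetic progression make u + v = 0 with u, v ≠ 0. The derivative
  -- of the constant coefficient in f is -uv, hence nonzero.
  let x : Fin 5 → ℂ := ![5, 5, 7, 1, 10]
  refine Polynomial.irreducible_of_eisenstein_criterion (P := RingHom.ker (eval x))
    (RingHom.ker_isPrime _) ?_ ?_ ?_ ?_ ?_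
  · rw [hlead, RingHom.mem_ker]
    simp [x]
  · intro n hn
    rw [Polynomial.degree_eq_natDegree hp0, hdeg] at hn
    have hn : n < 4 := by exact_mod_cast hn
    rw [RingHom.mem_ker]
    interval_cases n
    · rw [hc0]
      simp [cayleyMengerCoeffZero, cayleyMenger, x]
      norm_num
    · simp [hcoeff]
    · simp [hcoeff, cayleyMengerCoeffTwo, x]
      norm_num
    · simp [hcoeff]
  · rw [Polynomial.degree_eq_natDegree hp0, hdeg]
    norm_num
  · rw [hc0]
    intro h
    have h2 := eval_pderiv_eq_zero_of_mem_sq h 4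
    simp [cayleyMengerCoeffZero, cayleyMenger, x, pderiv_X, Derivation.leibniz_pow]
      at h2
    norm_num at h2
  · intro r hr
    -- Primitivity: a constant divisor divides the leading coefficient, so it is associated to a
    -- power of `X 4`, and `X 4` does not divide the constant coefficient.
    have h4 : r ∣ X 4 ^ 2 := by
      have := (Polynomial.C_dvd_iff_dvd_coeff r p).1 hr 4
      rwa [hc4, dvd_neg] at this
    have h0 : r ∣ cayleyMengerCoeffZero := by
      have := (Polynomial.C_dvd_iff_dvd_coeff r p).1 hr 0
      rwa [hc0] at this
    obtain ⟨k, -, hk⟩ := (dvd_prime_pow (X_prime (R := ℂ) (i := (4 : Fin 5))) 2).1 h4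
    rcases Nat.eq_zero_or_pos k with rfl | hkpos
    · exact hk.symm.isUnit (by simp)
    · exfalso
      have hX : X 4 ∣ cayleyMengerCoeffZero :=
        ((dvd_pow_self _ hkpos.ne').trans hk.symm.dvd).trans h0
      obtain ⟨q, hq⟩ := hX
      -- At this point `X 4` is 0 while the constant coefficient is 15 - 9 - 4 = 2.
      have := congrArg (eval ![1, 2, 0, 1, 0]) hq
      simp [cayleyMengerCoeffZero, cayleyMenger] at this
      norm_num at this

theorem irreducible_cayleyMengerPoly : Irreducible cayleyMengerPoly := by
  have h6 : Irreducible cayleyMengerPolyFin := by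
    rw [← MulEquiv.irreducible_iff (finSuccEquiv ℂ 5).toMulEquiv]
    have := irreducible_quartic_cayleyMenger
    rw [← finSuccEquiv_cayleyMengerPolyFin] at this
    exact this
  rw [← MulEquiv.irreducible_iff
    (renameEquiv ℂ (Equiv.ofBijective _ tetrahedronEdge_bijective)).toMulEquiv] at h6
  exact h6

end CayleyMenger

/-! ### Realizing complex symmetric matrices as Gram matrices. -/

section Gram

lemma exists_eq_sq (a : ℂ) : ∃ s, a = s ^ 2 :=
  (IsAlgClosed.exists_pow_nat_eq a two_pos).imp fun _ h => h.symm

/-- Every complex symmetric `2 × 2` matrix is the Gram matrix of two vectors of `ℂ²`. -/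
lemma exists_gram_two (a b h : ℂ) : ∃ x₁ y₁ x₂ y₂ : ℂ,
    x₁ ^ 2 + y₁ ^ 2 = a ∧ x₂ ^ 2 + y₂ ^ 2 = b ∧ x₁ * x₂ + y₁ * y₂ = h := by
  have aux : ∀ a b h : ℂ, a ≠ 0 → ∃ x₁ y₁ x₂ y₂ : ℂ,
      x₁ ^ 2 + y₁ ^ 2 = a ∧ x₂ ^ 2 + y₂ ^ 2 = b ∧ x₁ * x₂ + y₁ * y₂ = h := by
    intro a b h ha
    obtain ⟨s, hs⟩ := exists_eq_sq a
    have hs0 : s ≠ 0 := by rintro rfl; exact ha (by simpa using hs)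
    obtain ⟨t, ht⟩ := exists_eq_sq (b - (h / s) ^ 2)
    refine ⟨s, 0, h / s, t, by rw [hs]; ring, by rw [← ht]; ring, ?_⟩
    field_simp
    ring
  by_cases ha : a = 0
  · by_cases hb : b = 0
    · subst ha hb
      -- Both vectors must be isotropic: multiples of (1, i) and (1, -i), whose product is 2.
      refine ⟨1, Complex.I, h / 2, -Complex.I * h / 2, ?_, ?_, ?_⟩
      · linear_combination Complex.I_sq
      · linear_combination (h ^ 2 / 4) * Complex.I_sq
      · linear_combination (-h / 2) * Complex.I_sq
    · obtain ⟨x₁, y₁, x₂, y₂, h₁, h₂, h₃⟩ := aux b a h hb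
      exact ⟨x₂, y₂, x₁, y₁, h₂, h₁, by rw [← h₃]; ring⟩
  · exact aux a b h ha

/-- A singular complex symmetric `3 × 3` matrix whose leading `2 × 2` minor does not vanish is the
Gram matrix of three vectors of `ℂ²`. -/
lemma exists_gram_three_of_minor_ne_zero {a b c h k g : ℂ} (hm : a * b - h ^ 2 ≠ 0)
    (hdet : a * b * c + 2 * h * k * g - a * g ^ 2 - b * k ^ 2 - c * h ^ 2 = 0) :
    ∃ x₁ y₁ x₂ y₂ x₃ y₃ : ℂ,
      x₁ ^ 2 + y₁ ^ 2 = a ∧ x₂ ^ 2 + y₂ ^ 2 = b ∧ x₃ ^ 2 + y₃ ^ 2 = c ∧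
      x₁ * x₂ + y₁ * y₂ = h ∧ x₁ * x₃ + y₁ * y₃ = k ∧ x₂ * x₃ + y₂ * y₃ = g := by
  obtain ⟨x₁, y₁, x₂, y₂, h₁, h₂, h₃⟩ := exists_gram_two a b h
  set Δ := a * b - h ^ 2 with hΔ
  -- Cramer's rule: the third vector is sought as a combination of the first two with prescribed
  -- products `k`, `g`. Singularity then makes its square equal to `c`.
  set α := (k * b - g * h) / Δ with hα
  set β := (a * g - h * k) / Δ with hβ
  have e₁ : α * a + β * h = k := by
    rw [hα, hβ]; field_simp; rw [hΔ]; ring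
  have e₂ : α * h + β * b = g := by
    rw [hα, hβ]; field_simp; rw [hΔ]; ring
  have e₃ : α * k + β * g = c := by
    rw [hα, hβ]; field_simp; rw [hΔ]; linear_combination -hdet
  refine ⟨x₁, y₁, x₂, y₂, α * x₁ + β * x₂, α * y₁ + β * y₂, h₁, h₂, ?_, h₃, ?_, ?_⟩
  · linear_combination α ^ 2 * h₁ + β ^ 2 * h₂ + 2 * α * β * h₃ + α * e₁ + β * e₂ + e₃
  · linear_combination α * h₁ + β * h₃ + e₁
  · linear_combination α * h₃ + β * h₂ + e₂

/-- A complex symmetric `3 × 3` matrix with vanishing `2 × 2` minors has the form `v vᵀ`. -/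
lemma exists_gram_of_minors_eq_zero {a b c h k g : ℂ} (h₁ : b * c - g ^ 2 = 0)
    (h₂ : a * c - k ^ 2 = 0) (h₃ : a * b - h ^ 2 = 0) (h₁₂ : k * g - c * h = 0)
    (h₁₃ : h * g - b * k = 0) (h₂₃ : h * k - a * g = 0) :
    ∃ x y z : ℂ, x ^ 2 = a ∧ y ^ 2 = b ∧ z ^ 2 = c ∧ x * y = h ∧ x * z = k ∧ y * z = g := by
  by_cases ha : a = 0
  · subst ha
    have hh : h = 0 := by simpa using h₃
    have hk : k = 0 := by simpa using h₂
    subst hh hk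
    by_cases hb : b = 0
    · subst hb
      have hg : g = 0 := by simpa using h₁
      subst hg
      obtain ⟨s, hs⟩ := exists_eq_sq c
      exact ⟨0, 0, s, by simp, by simp, hs.symm, by simp, by simp, by simp⟩
    · obtain ⟨s, hs⟩ := exists_eq_sq b
      have hs0 : s ≠ 0 := by rintro rfl; exact hb (by simpa using hs)
      refine ⟨0, s, g / s, by simp, hs.symm, ?_, by simp, by simp, by field_simp⟩
      field_simp
      linear_combination -h₁ + c * hs
  · obtain ⟨s, hs⟩ := exists_eq_sq a
    have hs0 : s ≠ 0 := by rintro rfl; exact ha (by simpa using hs)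
    refine ⟨s, h / s, k / s, hs.symm, ?_, ?_, by field_simp, by field_simp, ?_⟩
    · field_simp
      linear_combination -h₃ + b * hs
    · field_simp
      linear_combination -h₂ + c * hs
    · field_simp
      linear_combination h₂₃ + g * hs

/-- A singular complex symmetric `3 × 3` matrix is the Gram matrix of three vectors of `ℂ²`. -/
lemma exists_gram_three {a b c h k g : ℂ}
    (hdet : a * b * c + 2 * h * k * g - a * g ^ 2 - b * k ^ 2 - c * h ^ 2 = 0) :
    ∃ x₁ y₁ x₂ y₂ x₃ y₃ : ℂ,
      x₁ ^ 2 + y₁ ^ 2 = a ∧ x₂ ^ 2 + y₂ ^ 2 = b ∧ x₃ ^ 2 + y₃ ^ 2 = c ∧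
      x₁ * x₂ + y₁ * y₂ = h ∧ x₁ * x₃ + y₁ * y₃ = k ∧ x₂ * x₃ + y₂ * y₃ = g := by
  by_cases h₃ : a * b - h ^ 2 = 0
  swap
  · exact exists_gram_three_of_minor_ne_zero h₃ hdet
  by_cases h₂ : a * c - k ^ 2 = 0
  swap
  · obtain ⟨x₁, y₁, x₂, y₂, x₃, y₃, e₁, e₂, e₃, e₄, e₅, e₆⟩ :=
      exists_gram_three_of_minor_ne_zero (c := b) (k := h) (g := g) h₂
        (by linear_combination hdet)
    exact ⟨x₁, y₁, x₃, y₃, x₂, y₂, e₁, e₃, e₂, e₅, e₄, by rw [← e₆]; ring⟩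
  by_cases h₁ : b * c - g ^ 2 = 0
  swap
  · obtain ⟨x₁, y₁, x₂, y₂, x₃, y₃, e₁, e₂, e₃, e₄, e₅, e₆⟩ :=
      exists_gram_three_of_minor_ne_zero (c := a) (k := h) (g := k) h₁
        (by linear_combination hdet)
    exact ⟨x₃, y₃, x₁, y₁, x₂, y₂, e₃, e₁, e₂, by rw [← e₅]; ring, by rw [← e₆]; ring, e₄⟩
  -- When det = 0, Jacobi's identity makes the square of each off-diagonal cofactor the product of
  -- two principal minors. So all cofactors vanish and the rank is at most one.
  obtain ⟨x, y, z, e₁, e₂, e₃, e₄, e₅, e₆⟩ := exists_gram_of_minors_eq_zero h₁ h₂ h₃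
    (pow_eq_zero_iff two_ne_zero |>.1 (by linear_combination (a * c - k ^ 2) * h₁ - c * hdet))
    (pow_eq_zero_iff two_ne_zero |>.1 (by linear_combination (a * b - h ^ 2) * h₁ - b * hdet))
    (pow_eq_zero_iff two_ne_zero |>.1 (by linear_combination (a * b - h ^ 2) * h₂ - a * hdet))
  exact ⟨x, 0, y, 0, z, 0, by simpa using e₁, by simpa using e₂, by simpa using e₃,
    by simpa using e₄, by simpa using e₅, by simpa using e₆⟩

end Gram

/-! ### Affine dependencies from the adjugate of the Gram matrix. -/

section Stress

/-- The cofactors of the Gram matrix of four points with squared lengths `a, …, f` vanish. -/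
structure GramCofactorsVanish (a b c d e f : ℂ) : Prop where
  c₁₁ : 4 * b * c - (b + c - f) ^ 2 = 0
  c₂₂ : 4 * a * c - (a + c - e) ^ 2 = 0
  c₃₃ : 4 * a * b - (a + b - d) ^ 2 = 0
  c₁₂ : (a + c - e) * (b + c - f) - 2 * c * (a + b - d) = 0
  c₁₃ : (a + b - d) * (b + c - f) - 2 * b * (a + c - e) = 0
  c₂₃ : (a + b - d) * (a + c - e) - 2 * a * (b + c - f) = 0

/-- Jacobi's identity again: on det = 0 the principal minors control the off-diagonal cofactors. -/
lemma minor_ne_zero_of_not_gramCofactorsVanish {a b c d e f : ℂ}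
    (hcm : cayleyMenger a b c d e f = 0) (hne : ¬ GramCofactorsVanish a b c d e f) :
    4 * b * c - (b + c - f) ^ 2 ≠ 0 ∨ 4 * a * c - (a + c - e) ^ 2 ≠ 0 ∨
      4 * a * b - (a + b - d) ^ 2 ≠ 0 := by
  by_contra! h
  obtain ⟨h₁, h₂, h₃⟩ := h
  rw [cayleyMenger] at hcm
  refine hne ⟨h₁, h₂, h₃, ?_, ?_, ?_⟩
  · refine pow_eq_zero_iff two_ne_zero |>.1 ?_
    linear_combination (4 * a * c - (a + c - e) ^ 2) * h₁ - 4 * c * hcm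
  · refine pow_eq_zero_iff two_ne_zero |>.1 ?_
    linear_combination (4 * a * b - (a + b - d) ^ 2) * h₁ - 4 * b * hcm
  · refine pow_eq_zero_iff two_ne_zero |>.1 ?_
    linear_combination (4 * a * b - (a + b - d) ^ 2) * h₂ - 4 * a * hcm

/-- A nontrivial affine dependency `w` of four coplanar, noncollinear points; its products
`wᵢ wⱼ` are proportional to the partial derivatives of the Cayley–Menger determinant. -/
lemma exists_affine_dependency {a b c d e f : ℂ} (hcm : cayleyMenger a b c d e f = 0)
    (hne : ¬ GramCofactorsVanish a b c d e f) :
    ∃ w₀ w₁ w₂ w₃ t K : ℂ, (w₁ ≠ 0 ∨ w₂ ≠ 0 ∨ w₃ ≠ 0) ∧ w₀ + w₁ + w₂ + w₃ = 0 ∧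
      (a * w₁ + b * w₂ + c * w₃ = K ∧ a * w₀ + d * w₂ + e * w₃ = K ∧
        b * w₀ + d * w₁ + f * w₃ = K ∧ c * w₀ + e * w₁ + f * w₂ = K) ∧
      w₁ * w₂ = t * ((a + c - e) * (b + c - f) - 2 * c * (a + b - d)) ∧
      w₁ * w₃ = t * ((a + b - d) * (b + c - f) - 2 * b * (a + c - e)) ∧
      w₂ * w₃ = t * ((a + b - d) * (a + c - e) - 2 * a * (b + c - f)) ∧
      w₁ ^ 2 = t * (4 * b * c - (b + c - f) ^ 2) ∧
      w₂ ^ 2 = t * (4 * a * c - (a + c - e) ^ 2) ∧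
      w₃ ^ 2 = t * (4 * a * b - (a + b - d) ^ 2) := by
  have hm := minor_ne_zero_of_not_gramCofactorsVanish hcm hne
  rw [cayleyMenger] at hcm
  -- Being in the kernel of the Gram matrix is restated in squared lengths: with w₀ = -(w₁ + w₂ +
  -- w₃), the sum ∑ₖ m_jk wₖ is the same for all j.
  have hr₁ : ∀ w₁ w₂ w₃ : ℂ, 2 * a * w₁ + (a + b - d) * w₂ + (a + c - e) * w₃ = 0 →
      (a + b - d) * w₁ + 2 * b * w₂ + (b + c - f) * w₃ = 0 →
      (a + c - e) * w₁ + (b + c - f) * w₂ + 2 * c * w₃ = 0 →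
      a * w₁ + b * w₂ + c * w₃ = a * w₁ + b * w₂ + c * w₃ ∧
      a * -(w₁ + w₂ + w₃) + d * w₂ + e * w₃ = a * w₁ + b * w₂ + c * w₃ ∧
      b * -(w₁ + w₂ + w₃) + d * w₁ + f * w₃ = a * w₁ + b * w₂ + c * w₃ ∧
      c * -(w₁ + w₂ + w₃) + e * w₁ + f * w₂ = a * w₁ + b * w₂ + c * w₃ := by
    intro w₁ w₂ w₃ h₁ h₂ h₃
    exact ⟨rfl, by linear_combination -h₁, by linear_combination -h₂, by linear_combination -h₃⟩
  rcases hm with hm | hm | hm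
  · refine ⟨_, 4 * b * c - (b + c - f) ^ 2, (a + c - e) * (b + c - f) - 2 * c * (a + b - d),
      (a + b - d) * (b + c - f) - 2 * b * (a + c - e), 4 * b * c - (b + c - f) ^ 2, _,
      Or.inl hm, ?_, hr₁ _ _ _ ?_ ?_ ?_, ?_, ?_, ?_, ?_, ?_, ?_⟩
    · ring
    · linear_combination 2 * hcm
    · ring
    · ring
    · ring
    · ring
    · linear_combination 2 * (b + c - f) * hcm
    · ring
    · linear_combination -4 * c * hcm
    · linear_combination -4 * b * hcm
  · refine ⟨_, (a + c - e) * (b + c - f) - 2 * c * (a + b - d), 4 * a * c - (a + c - e) ^ 2,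
      (a + b - d) * (a + c - e) - 2 * a * (b + c - f), 4 * a * c - (a + c - e) ^ 2, _,
      Or.inr (Or.inl hm), ?_, hr₁ _ _ _ ?_ ?_ ?_, ?_, ?_, ?_, ?_, ?_, ?_⟩
    · ring
    · ring
    · linear_combination 2 * hcm
    · ring
    · ring
    · linear_combination 2 * (a + c - e) * hcm
    · ring
    · linear_combination -4 * c * hcm
    · ring
    · linear_combination -4 * a * hcm
  · refine ⟨_, (a + b - d) * (b + c - f) - 2 * b * (a + c - e),
      (a + b - d) * (a + c - e) - 2 * a * (b + c - f), 4 * a * b - (a + b - d) ^ 2,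
      4 * a * b - (a + b - d) ^ 2, _,
      Or.inr (Or.inr hm), ?_, hr₁ _ _ _ ?_ ?_ ?_, ?_, ?_, ?_, ?_, ?_, ?_⟩
    · ring
    · ring
    · ring
    · linear_combination 2 * hcm
    · linear_combination 2 * (a + b - d) * hcm
    · ring
    · ring
    · linear_combination -4 * b * hcm
    · linear_combination -4 * a * hcm
    · ring

end Stress

/-! ### Equations of L_{2,4} and L_{1,4}. -/

section Lengths

lemma len_comm {n : ℕ} (i j : Fin n) : len i j = len j i := by
  unfold len
  rcases lt_trichotomy i j with h | h | h
  · simp [h, h.not_gt]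
  · simp [h]
  · simp [h, h.not_gt]

@[simp]
lemma len_self {n : ℕ} (i : Fin n) : len i i = 0 := by
  simp [len]

lemma len_of_lt {n : ℕ} {i j : Fin n} (h : i < j) (l : Edge n → ℂ) : len i j l = l ⟨(i, j), h⟩ := by
  simp [len, h]

lemma squaringMap_eq_sqLengths_iff {d n : ℕ} {l : Edge n → ℂ} {p : Fin n → Fin d → ℂ} :
    squaringMap l = sqLengths p ↔ ∀ i j, len i j l ^ 2 = ∑ k, (p i k - p j k) ^ 2 := by
  constructor
  · intro h i j
    rcases lt_trichotomy i j with hij | rfl | hij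
    · rw [len_of_lt hij]
      exact congrFun h ⟨(i, j), hij⟩
    · simp
    · rw [len_comm, len_of_lt hij]
      refine (congrFun h ⟨(j, i), hij⟩).trans (Finset.sum_congr rfl fun k _ => ?_)
      ring
  · intro h
    funext ⟨⟨i, j⟩, hij⟩
    refine Eq.trans ?_ (h i j)
    rw [len_of_lt hij]
    rfl

lemma mem_unsquaredMeasurementVariety_iff {d n : ℕ} {l : Edge n → ℂ} :
    l ∈ unsquaredMeasurementVariety d n ↔
      ∃ p : Fin n → Fin d → ℂ, ∀ i j, len i j l ^ 2 = ∑ k, (p i k - p j k) ^ 2 := by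
  simp only [← squaringMap_eq_sqLengths_iff]
  exact ⟨fun ⟨p, hp⟩ => ⟨p, hp.symm⟩, fun ⟨p, hp⟩ => ⟨p, hp.symm⟩⟩

/-- An identity between symmetric functions on pairs of vertices that vanish on the diagonal need
only be checked on the six edges. -/
lemma forall_pair_of_edges {F G : Fin 4 → Fin 4 → ℂ} (hF : ∀ i j, F i j = F j i)
    (hG : ∀ i j, G i j = G j i) (h0 : ∀ i, F i i = G i i) (h₀₁ : F 0 1 = G 0 1)
    (h₀₂ : F 0 2 = G 0 2) (h₀₃ : F 0 3 = G 0 3) (h₁₂ : F 1 2 = G 1 2) (h₁₃ : F 1 3 = G 1 3)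
    (h₂₃ : F 2 3 = G 2 3) (i j : Fin 4) : F i j = G i j := by
  have key : ∀ i j, i < j → F i j = G i j := by
    intro i j hij
    fin_cases i <;> fin_cases j <;> first | assumption | exact absurd hij (by decide)
  rcases lt_trichotomy i j with hij | rfl | hij
  · exact key i j hij
  · exact h0 i
  · rw [hF, hG]; exact key j i hij

/-- The Cayley–Menger determinant of a tetrahedron with edge lengths `l`. -/
def cayleyMengerOf (l : Edge 4 → ℂ) : ℂ :=
  cayleyMenger (len 0 1 l ^ 2) (len 0 2 l ^ 2) (len 0 3 l ^ 2) (len 1 2 l ^ 2) (len 1 3 l ^ 2)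
    (len 2 3 l ^ 2)

/-- With p₀ at the origin, polarization recovers the inner products from the squared lengths, so
realizability in ℂ² amounts to the Gram matrix being singular. -/
theorem mem_unsquaredMeasurementVariety_two_iff {l : Edge 4 → ℂ} :
    l ∈ unsquaredMeasurementVariety 2 4 ↔ cayleyMengerOf l = 0 := by
  rw [mem_unsquaredMeasurementVariety_iff]
  constructor
  · rintro ⟨p, hp⟩
    simp only [cayleyMengerOf, hp, Fin.sum_univ_two, cayleyMenger]
    ring
  · intro h
    rw [cayleyMengerOf, cayleyMenger] at h
    obtain ⟨x₁, y₁, x₂, y₂, x₃, y₃, h₁, h₂, h₃, h₄, h₅, h₆⟩ :=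
      exists_gram_three (a := len 0 1 l ^ 2) (b := len 0 2 l ^ 2) (c := len 0 3 l ^ 2)
        (h := (len 0 1 l ^ 2 + len 0 2 l ^ 2 - len 1 2 l ^ 2) / 2)
        (k := (len 0 1 l ^ 2 + len 0 3 l ^ 2 - len 1 3 l ^ 2) / 2)
        (g := (len 0 2 l ^ 2 + len 0 3 l ^ 2 - len 2 3 l ^ 2) / 2)
        (by linear_combination h / 4)
    refine ⟨![![0, 0], ![x₁, y₁], ![x₂, y₂], ![x₃, y₃]], ?_⟩
    apply forall_pair_of_edges
    · intro i j; rw [len_comm]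
    · intro i j; simp only [Fin.sum_univ_two]; ring
    · intro i; simp
    all_goals simp [Fin.sum_univ_two]
    · exact h₁.symm
    · exact h₂.symm
    · exact h₃.symm
    · linear_combination -h₁ - h₂ + 2 * h₄
    · linear_combination -h₁ - h₃ + 2 * h₅
    · linear_combination -h₂ - h₃ + 2 * h₆

theorem mem_unsquaredMeasurementVariety_one_iff {l : Edge 4 → ℂ} :
    l ∈ unsquaredMeasurementVariety 1 4 ↔
      GramCofactorsVanish (len 0 1 l ^ 2) (len 0 2 l ^ 2) (len 0 3 l ^ 2) (len 1 2 l ^ 2)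
        (len 1 3 l ^ 2) (len 2 3 l ^ 2) := by
  rw [mem_unsquaredMeasurementVariety_iff]
  constructor
  · rintro ⟨p, hp⟩
    simp only [hp, Finset.univ_unique, Finset.sum_singleton]
    constructor <;> ring
  · intro h
    obtain ⟨x, y, z, h₁, h₂, h₃, h₄, h₅, h₆⟩ :=
      exists_gram_of_minors_eq_zero (a := len 0 1 l ^ 2) (b := len 0 2 l ^ 2) (c := len 0 3 l ^ 2)
        (h := (len 0 1 l ^ 2 + len 0 2 l ^ 2 - len 1 2 l ^ 2) / 2)
        (k := (len 0 1 l ^ 2 + len 0 3 l ^ 2 - len 1 3 l ^ 2) / 2)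
        (g := (len 0 2 l ^ 2 + len 0 3 l ^ 2 - len 2 3 l ^ 2) / 2)
        (by linear_combination h.c₁₁ / 4) (by linear_combination h.c₂₂ / 4)
        (by linear_combination h.c₃₃ / 4) (by linear_combination h.c₁₂ / 4)
        (by linear_combination h.c₁₃ / 4) (by linear_combination h.c₂₃ / 4)
    refine ⟨fun i _ => ![0, x, y, z] i, ?_⟩
    apply forall_pair_of_edges
    · intro i j; rw [len_comm]
    · intro i j; simp only [Finset.univ_unique, Finset.sum_singleton]; ring
    · intro i; simp
    all_goals simp
    · exact h₁.symm
    · exact h₂.symm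
    · exact h₃.symm
    · linear_combination -h₁ - h₂ + 2 * h₄
    · linear_combination -h₁ - h₃ + 2 * h₅
    · linear_combination -h₂ - h₃ + 2 * h₆

end Lengths

/-! ### Sign choices for square roots. -/

section Signs

lemma sign_smul_sq (s : ℤˣ) (x : ℂ) : (s • x) ^ 2 = x ^ 2 := by
  rcases Int.units_eq_one_or s with rfl | rfl
  · rw [one_smul]
  · rw [Units.neg_smul, one_smul, neg_sq]

lemma exists_eq_sign_smul {x y : ℂ} (h : x ^ 2 = y ^ 2) : ∃ s : ℤˣ, x = s • y := by
  rcases sq_eq_sq_iff_eq_or_eq_neg.1 h with h | h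
  · exact ⟨1, by rw [one_smul, h]⟩
  · exact ⟨-1, by rw [Units.neg_smul, one_smul, h]⟩

lemma sign_smul_smul (s : ℤˣ) (x : ℂ) : s • s • x = x := by
  rcases Int.units_eq_one_or s with rfl | rfl <;> simp

end Signs

/-! ### The unions of the subspaces as conditions on lengths. -/

section Unions

lemma mem_subspaceI {s₁₃ s₂₃ s₁₄ s₂₄ s₃₄ : ℤˣ} {l : Edge 4 → ℂ} :
    l ∈ subspaceI s₁₃ s₂₃ s₁₄ s₂₄ s₃₄ ↔
      len 0 1 l - s₁₃ • len 0 2 l + s₂₃ • len 1 2 l = 0 ∧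
      len 0 1 l - s₁₄ • len 0 3 l + s₂₄ • len 1 3 l = 0 ∧
      s₁₃ • len 0 2 l - s₁₄ • len 0 3 l + s₃₄ • len 2 3 l = 0 := by
  simp [subspaceI, and_assoc]

lemma mem_subspaceII {i j : Fin 4} {s : Fin 4 → ℤˣ} {l : Edge 4 → ℂ} :
    l ∈ subspaceII i j s ↔
      len i j l = 0 ∧ ∀ k, k ≠ i → k ≠ j → len i k l = s k • len j k l := by
  simp [subspaceII, Submodule.mem_iInf, sub_eq_zero]

lemma mem_subspaceIII {i j k : Fin 4} {l : Edge 4 → ℂ} :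
    l ∈ subspaceIII i j k ↔ len i j l = 0 ∧ len i k l = 0 ∧ len j k l = 0 := by
  simp [subspaceIII, and_assoc]

lemma mem_iUnion_typeI {l : Edge 4 → ℂ} :
    l ∈ (⋃ W ∈ typeI, (W : Set (Edge 4 → ℂ))) ↔ l ∈ unsquaredMeasurementVariety 1 4 := by
  have hU : l ∈ (⋃ W ∈ typeI, (W : Set (Edge 4 → ℂ))) ↔
      ∃ s₁₃ s₂₃ s₁₄ s₂₄ s₃₄ : ℤˣ, l ∈ subspaceI s₁₃ s₂₃ s₁₄ s₂₄ s₃₄ := by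
    simp only [Set.mem_iUnion, typeI]
    constructor
    · rintro ⟨W, ⟨s₁, s₂, s₃, s₄, s₅, rfl⟩, hl⟩
      exact ⟨s₁, s₂, s₃, s₄, s₅, hl⟩
    · rintro ⟨s₁, s₂, s₃, s₄, s₅, hl⟩
      exact ⟨_, ⟨s₁, s₂, s₃, s₄, s₅, rfl⟩, hl⟩
  rw [hU, mem_unsquaredMeasurementVariety_iff]
  simp only [Finset.univ_unique, Finset.sum_singleton]
  constructor
  · rintro ⟨s₁₃, s₂₃, s₁₄, s₂₄, s₃₄, hl⟩
    obtain ⟨h₁, h₂, h₃⟩ := mem_subspaceI.1 hl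
    -- With p₀ at the origin, the signed lengths of the edges at p₀ are the differences p₀ - pᵢ.
    refine ⟨fun i _ => ![0, -len 0 1 l, -(s₁₃ • len 0 2 l), -(s₁₄ • len 0 3 l)] i, ?_⟩
    apply forall_pair_of_edges
    · intro i j; rw [len_comm]
    · intro i j; ring
    · intro i; simp
    all_goals simp
    · rw [sign_smul_sq]
    · rw [sign_smul_sq]
    · rw [← sign_smul_sq s₂₃, ← neg_sq, eq_neg_of_add_eq_zero_right h₁]; ring
    · rw [← sign_smul_sq s₂₄, ← neg_sq, eq_neg_of_add_eq_zero_right h₂]; ring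
    · rw [← sign_smul_sq s₃₄, ← neg_sq, eq_neg_of_add_eq_zero_right h₃]; ring
  · rintro ⟨p, hp⟩
    obtain ⟨s₁₂, h₁₂⟩ := exists_eq_sign_smul (hp 0 1).symm
    obtain ⟨s₁₃, h₁₃⟩ := exists_eq_sign_smul (hp 0 2).symm
    obtain ⟨s₁₄, h₁₄⟩ := exists_eq_sign_smul (hp 0 3).symm
    obtain ⟨s₂₃, h₂₃⟩ := exists_eq_sign_smul (hp 1 2).symm
    obtain ⟨s₂₄, h₂₄⟩ := exists_eq_sign_smul (hp 1 3).symm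
    obtain ⟨s₃₄, h₃₄⟩ := exists_eq_sign_smul (hp 2 3).symm
    -- Six signs arise, but a global change of sign preserves the equations. Multiplying by s₁₂
    -- normalizes the sign of l₁₂ to 1, leaving five.
    refine ⟨s₁₂ * s₁₃, s₁₂ * s₂₃, s₁₂ * s₁₄, s₁₂ * s₂₄, s₁₂ * s₃₄, mem_subspaceI.2 ?_⟩
    simp only [mul_smul, ← h₁₃, ← h₁₄, ← h₂₃, ← h₂₄, ← h₃₄]
    rw [← sign_smul_smul s₁₂ (len 0 1 l), ← h₁₂]
    simp only [← smul_sub, ← smul_add]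
    exact ⟨by ring_nf; simp, by ring_nf; simp, by ring_nf; simp⟩

lemma mem_iUnion_typeIIAt {i j : Fin 4} {l : Edge 4 → ℂ} :
    l ∈ (⋃ W ∈ typeIIAt i j, (W : Set (Edge 4 → ℂ))) ↔
      len i j l = 0 ∧ ∀ k, k ≠ i → k ≠ j → len i k l ^ 2 = len j k l ^ 2 := by
  simp only [Set.mem_iUnion, typeIIAt]
  constructor
  · rintro ⟨W, ⟨s, rfl⟩, hl⟩
    obtain ⟨h₀, h⟩ := mem_subspaceII.1 hl
    exact ⟨h₀, fun k hi hj => by rw [h k hi hj, sign_smul_sq]⟩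
  · rintro ⟨h₀, h⟩
    have : ∀ k, ∃ s : ℤˣ, k ≠ i → k ≠ j → len i k l = s • len j k l := by
      intro k
      by_cases hk : k ≠ i ∧ k ≠ j
      · obtain ⟨s, hs⟩ := exists_eq_sign_smul (h k hk.1 hk.2)
        exact ⟨s, fun _ _ => hs⟩
      · exact ⟨1, fun hi hj => absurd ⟨hi, hj⟩ hk⟩
    choose s hs using this
    exact ⟨_, ⟨s, rfl⟩, mem_subspaceII.2 ⟨h₀, hs⟩⟩

lemma mem_iUnion_typeII {l : Edge 4 → ℂ} :
    l ∈ (⋃ W ∈ typeII, (W : Set (Edge 4 → ℂ))) ↔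
      ∃ i j, i ≠ j ∧ len i j l = 0 ∧ ∀ k, k ≠ i → k ≠ j → len i k l ^ 2 = len j k l ^ 2 := by
  have hU : l ∈ (⋃ W ∈ typeII, (W : Set (Edge 4 → ℂ))) ↔
      ∃ i j, i < j ∧ l ∈ (⋃ W ∈ typeIIAt i j, (W : Set (Edge 4 → ℂ))) := by
    simp only [Set.mem_iUnion, typeII]
    constructor
    · rintro ⟨W, ⟨i, j, hij, hW⟩, hl⟩
      exact ⟨i, j, hij, W, hW, hl⟩
    · rintro ⟨i, j, hij, W, hW, hl⟩
      exact ⟨W, ⟨i, j, hij, hW⟩, hl⟩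
  simp only [hU, mem_iUnion_typeIIAt]
  constructor
  · rintro ⟨i, j, hij, h⟩
    exact ⟨i, j, hij.ne, h⟩
  · rintro ⟨i, j, hij, h₀, h⟩
    rcases lt_or_gt_of_ne hij with hlt | hlt
    · exact ⟨i, j, hlt, h₀, h⟩
    · exact ⟨j, i, hlt, by rw [len_comm, h₀], fun k hj hi => (h k hi hj).symm⟩

lemma mem_iUnion_typeIII {l : Edge 4 → ℂ} :
    l ∈ (⋃ W ∈ typeIII, (W : Set (Edge 4 → ℂ))) ↔
      ∃ h, ∀ i j, i ≠ h → j ≠ h → len i j l = 0 := by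
  simp only [Set.mem_iUnion, typeIII]
  constructor
  · rintro ⟨W, ⟨i, j, k, hij, hjk, rfl⟩, hl⟩
    obtain ⟨h₁, h₂, h₃⟩ := mem_subspaceIII.1 hl
    obtain ⟨h, hh⟩ : ∃ h : Fin 4, ∀ x, x ≠ h → x = i ∨ x = j ∨ x = k := by
      clear hl h₁ h₂ h₃; revert i j k; decide
    refine ⟨h, fun x y hx hy => ?_⟩
    rcases hh x hx with rfl | rfl | rfl <;> rcases hh y hy with rfl | rfl | rfl <;>
      first | assumption | (rw [len_comm]; assumption) | simp
  · rintro ⟨h, hl⟩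
    obtain ⟨i, j, k, hij, hjk, hi, hj, hk⟩ :
        ∃ i j k : Fin 4, i < j ∧ j < k ∧ i ≠ h ∧ j ≠ h ∧ k ≠ h := by
      clear hl; revert h; decide
    exact ⟨_, ⟨i, j, k, hij, hjk, rfl⟩,
      mem_subspaceIII.2 ⟨hl _ _ hi hj, hl _ _ hi hk, hl _ _ hj hk⟩⟩

/-- The union of the type II subspaces for the edge `ij` consists of the lengths of the planar
configurations with `pᵢ = pⱼ`. -/
theorem iUnion_typeIIAt_eq {i j : Fin 4} (hij : i < j) :
    (⋃ W ∈ typeIIAt i j, (W : Set (Edge 4 → ℂ)))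
      = {l | ∃ p : Fin 4 → Fin 2 → ℂ, p i = p j ∧ squaringMap l = sqLengths p} := by
  ext l
  simp only [mem_iUnion_typeIIAt, squaringMap_eq_sqLengths_iff, Set.mem_ofPred_eq]
  constructor
  · rintro ⟨h₀, h⟩
    obtain ⟨k, m, hki, hkj, hmi, hmj, hkm, hall⟩ : ∃ k m : Fin 4, k ≠ i ∧ k ≠ j ∧ m ≠ i ∧ m ≠ j ∧
        k ≠ m ∧ ∀ x, x = i ∨ x = j ∨ x = k ∨ x = m := by
      clear h₀ h; revert i j; decide
    have hk := h k hki hkj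
    have hm := h m hmi hmj
    -- The collapsed points go to the origin. The remaining triangle is unconstrained, since every
    -- symmetric 2 × 2 matrix is a Gram matrix.
    obtain ⟨x₁, y₁, x₂, y₂, e₁, e₂, e₃⟩ := exists_gram_two (len j k l ^ 2) (len j m l ^ 2)
      ((len j k l ^ 2 + len j m l ^ 2 - len k m l ^ 2) / 2)
    have e₄ : len k m l ^ 2 = (x₁ - x₂) ^ 2 + (y₁ - y₂) ^ 2 := by
      linear_combination -e₁ - e₂ + 2 * e₃
    let p : Fin 4 → Fin 2 → ℂ :=
      fun x => if x = k then ![x₁, y₁] else if x = m then ![x₂, y₂] else 0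
    have pi : p i = 0 := by simp [p, hki.symm, hmi.symm]
    have pj : p j = 0 := by simp [p, hkj.symm, hmj.symm]
    have pk : p k = ![x₁, y₁] := by simp [p]
    have pm : p m = ![x₂, y₂] := by simp [p, hkm.symm]
    refine ⟨p, by rw [pi, pj], fun x y => ?_⟩
    rw [Fin.sum_univ_two]
    have h₀' := len_comm j i ▸ h₀
    have c₁ : len k i l = len i k l := by rw [len_comm]
    have c₂ : len k j l = len j k l := by rw [len_comm]
    have c₃ : len m i l = len i m l := by rw [len_comm]
    have c₄ : len m j l = len j m l := by rw [len_comm]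
    have c₅ : len m k l = len k m l := by rw [len_comm]
    rcases hall x with rfl | rfl | rfl | rfl <;> rcases hall y with rfl | rfl | rfl | rfl <;>
      simp only [pi, pj, pk, pm, len_self, LinearMap.zero_apply, Pi.zero_apply,
        Matrix.cons_val_zero, Matrix.cons_val_one, h₀, h₀', c₁, c₂, c₃, c₄, c₅, hk, hm, ← e₁, ← e₂,
        e₄] <;>
      ring
  · rintro ⟨p, hp, h⟩
    refine ⟨?_, fun k _ _ => by rw [h, h, hp]⟩
    have := h i j
    simpa [hp] using this

end Unions

/-! ### Critical points of the Cayley–Menger polynomial. -/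

section Singular

open MvPolynomial

lemma eval_cayleyMengerPoly (l : Edge 4 → ℂ) : eval l cayleyMengerPoly = cayleyMengerOf l := by
  rw [cayleyMengerPoly, eval_rename, cayleyMengerPolyFin, map_cayleyMenger]
  simp only [map_pow, eval_X]
  rfl

lemma eval_pderiv_cayleyMengerPoly (l : Edge 4 → ℂ) (k : Fin 6) :
    eval l (pderiv (tetrahedronEdge k) cayleyMengerPoly) =
      eval (l ∘ tetrahedronEdge) (pderiv k cayleyMengerPolyFin) := by
  rw [cayleyMengerPoly, pderiv_rename tetrahedronEdge_bijective.injective, eval_rename]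

/-- The partial derivatives of `cayleyMenger` with respect to its six arguments. -/
def cayleyMengerPartial (a b c d e f : ℂ) : Fin 6 → ℂ :=
  let c₁₁ := 4 * b * c - (b + c - f) ^ 2
  let c₂₂ := 4 * a * c - (a + c - e) ^ 2
  let c₃₃ := 4 * a * b - (a + b - d) ^ 2
  let c₁₂ := (a + c - e) * (b + c - f) - 2 * c * (a + b - d)
  let c₁₃ := (a + b - d) * (b + c - f) - 2 * b * (a + c - e)
  let c₂₃ := (a + b - d) * (a + c - e) - 2 * a * (b + c - f)
  ![c₁₁ + c₁₂ + c₁₃, c₂₂ + c₁₂ + c₂₃, c₃₃ + c₁₃ + c₂₃, -c₁₂, -c₁₃, -c₂₃]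

lemma eval_pderiv_cayleyMengerPolyFin (y : Fin 6 → ℂ) (k : Fin 6) :
    eval y (pderiv k cayleyMengerPolyFin) = 2 * y k *
      cayleyMengerPartial (y 0 ^ 2) (y 1 ^ 2) (y 2 ^ 2) (y 3 ^ 2) (y 4 ^ 2) (y 5 ^ 2) k := by
  have h4 (k : Fin 6) : pderiv k (4 : MvPolynomial (Fin 6) ℂ) = 0 := (pderiv k).map_natCast 4
  fin_cases k <;>
  · simp [h4, cayleyMengerPolyFin, cayleyMenger, cayleyMengerPartial, pderiv_X,
      Derivation.leibniz_pow]
    ring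

lemma forall_eval_pderiv_cayleyMengerPoly_eq_zero_iff (l : Edge 4 → ℂ) :
    (∀ e, eval l (pderiv e cayleyMengerPoly) = 0) ↔
      let D := cayleyMengerPartial (len 0 1 l ^ 2) (len 0 2 l ^ 2) (len 0 3 l ^ 2) (len 1 2 l ^ 2)
        (len 1 3 l ^ 2) (len 2 3 l ^ 2)
      len 0 1 l * D 0 = 0 ∧ len 0 2 l * D 1 = 0 ∧ len 0 3 l * D 2 = 0 ∧ len 1 2 l * D 3 = 0 ∧
        len 1 3 l * D 4 = 0 ∧ len 2 3 l * D 5 = 0 := by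
  rw [tetrahedronEdge_bijective.surjective.forall]
  simp only [eval_pderiv_cayleyMengerPoly, eval_pderiv_cayleyMengerPolyFin, mul_assoc,
    mul_eq_zero_iff_left (two_ne_zero (α := ℂ)), Fin.forall_fin_succ, IsEmpty.forall_iff, and_true]
  rfl

/-- If the lengths of the edges on which the affine dependency `w` of four points has nonzero
products vanish, then two points coincide or three points have pairwise vanishing distances. -/
lemma mem_typeII_or_typeIII_of_affine_dependency {l : Edge 4 → ℂ} {w : Fin 4 → ℂ} {K : ℂ}
    (hw : w ≠ 0) (hsum : ∑ i, w i = 0) (hK : ∀ j, ∑ k, len j k l ^ 2 * w k = K)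
    (hl : ∀ i j, len i j l * (w i * w j) = 0) :
    (∃ i j, i ≠ j ∧ len i j l = 0 ∧ ∀ k, k ≠ i → k ≠ j → len i k l ^ 2 = len j k l ^ 2) ∨
      ∃ h, ∀ i j, i ≠ h → j ≠ h → len i j l = 0 := by
  have hl' : ∀ i j, w i ≠ 0 → w j ≠ 0 → len i j l = 0 := fun i j hi hj =>
    (mul_eq_zero.1 (hl i j)).resolve_right (mul_ne_zero hi hj)
  obtain ⟨i, hi⟩ := Function.ne_iff.1 hw
  obtain ⟨j, hji, hj⟩ : ∃ j, j ≠ i ∧ w j ≠ 0 := by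
    by_contra! h
    rw [Finset.sum_eq_single i (fun j _ hj => h j hj) (by simp)] at hsum
    exact hi hsum
  by_cases hk : ∃ k, k ≠ i ∧ k ≠ j ∧ w k ≠ 0
  · right
    obtain ⟨k, hki, hkj, hk⟩ := hk
    obtain ⟨h, hh⟩ : ∃ h : Fin 4, ∀ x, x ≠ h → x = i ∨ x = j ∨ x = k := by
      clear hi hj hk; revert i j k; decide
    have hne : ∀ x, x ≠ h → w x ≠ 0 := by
      intro x hx
      rcases hh x hx with rfl | rfl | rfl <;> assumption
    exact ⟨h, fun x y hx hy => hl' x y (hne x hx) (hne y hy)⟩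
  · left
    push Not at hk
    -- Only wᵢ and wⱼ = -wᵢ survive, so weighted sums become differences of values at i and j.
    have hpair : ∀ g : Fin 4 → ℂ, ∑ x, g x * w x = (g i - g j) * w i := by
      intro g
      have hz : ∀ g : Fin 4 → ℂ, ∑ x, g x * w x = g i * w i + g j * w j := fun g =>
        Fintype.sum_eq_add i j hji.symm fun x hx => by rw [hk x hx.1 hx.2, mul_zero]
      have h1 := hz 1
      simp only [Pi.one_apply, one_mul, hsum] at h1
      rw [hz g]
      linear_combination -g j * h1
    have h₀ : len i j l = 0 := hl' i j hi hj
    -- Evaluating the common sum at vertex i itself gives K = -l_ij² wᵢ = 0.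
    have hK0 : K = 0 := by
      rw [← hK i, hpair, len_self, h₀]
      simp
    refine ⟨i, j, hji.symm, h₀, fun k _ _ => ?_⟩
    have h := hK k
    rw [hpair, hK0] at h
    rw [len_comm i k, len_comm j k]
    exact sub_eq_zero.1 ((mul_eq_zero.1 h).resolve_right hi)

/-- The points of `L_{2,4}` at which the gradient of the Cayley–Menger polynomial vanishes. -/
lemma cayleyMengerPoly_critical_iff {l : Edge 4 → ℂ} :
    (cayleyMengerOf l = 0 ∧ ∀ e, eval l (pderiv e cayleyMengerPoly) = 0) ↔
      l ∈ unsquaredMeasurementVariety 1 4 ∨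
      (∃ i j, i ≠ j ∧ len i j l = 0 ∧ ∀ k, k ≠ i → k ≠ j → len i k l ^ 2 = len j k l ^ 2) ∨
      ∃ h, ∀ i j, i ≠ h → j ≠ h → len i j l = 0 := by
  rw [forall_eval_pderiv_cayleyMengerPoly_eq_zero_iff, mem_unsquaredMeasurementVariety_one_iff]
  simp only [cayleyMengerPartial, Matrix.cons_val]
  rw [cayleyMengerOf]
  constructor
  · rintro ⟨hcm, g₀₁, g₀₂, g₀₃, g₁₂, g₁₃, g₂₃⟩
    refine or_iff_not_imp_left.2 fun hne => ?_
    obtain ⟨w₀, w₁, w₂, w₃, t, K, hw, hsum, ⟨k₀, k₁, k₂, k₃⟩, p₁₂, p₁₃, p₂₃, q₁, q₂, q₃⟩ :=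
      exists_affine_dependency hcm hne
    have hw₀ : w₀ = -(w₁ + w₂ + w₃) := by linear_combination hsum
    refine mem_typeII_or_typeIII_of_affine_dependency (w := ![w₀, w₁, w₂, w₃]) (K := K) ?_ ?_ ?_ ?_
    · intro h
      have h₁ := congrFun h 1
      have h₂ := congrFun h 2
      have h₃ := congrFun h 3
      simp at h₁ h₂ h₃
      simp [h₁, h₂, h₃] at hw
    · simpa [Fin.sum_univ_four] using hsum
    · simp only [Fin.forall_fin_succ, IsEmpty.forall_iff, Fin.sum_univ_four]
      simp [len_comm 1 0, len_comm 2 0, len_comm 3 0, len_comm 2 1, len_comm 3 1, len_comm 3 2]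
      exact ⟨k₀, k₁, k₂, k₃⟩
    · apply forall_pair_of_edges (G := fun _ _ => 0)
      · intro i j; rw [len_comm]; ring
      · intro i j; rfl
      · intro i; simp
      all_goals simp only [Matrix.cons_val]
      -- For an edge at vertex 0 the partial derivative is a row sum of cofactors; multiplied by t
      -- it is wᵢ(w₁ + w₂ + w₃) = -w₀ wᵢ.
      · rw [hw₀]
        linear_combination -t * g₀₁ - len 0 1 l * (q₁ + p₁₂ + p₁₃)
      · rw [hw₀]
        linear_combination -t * g₀₂ - len 0 2 l * (q₂ + p₁₂ + p₂₃)
      · rw [hw₀]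
        linear_combination -t * g₀₃ - len 0 3 l * (q₃ + p₁₃ + p₂₃)
      · linear_combination -t * g₁₂ + len 1 2 l * p₁₂
      · linear_combination -t * g₁₃ + len 1 3 l * p₁₃
      · linear_combination -t * g₂₃ + len 2 3 l * p₂₃
  · rintro (h | ⟨i, j, hij, h₀, h⟩ | ⟨h, hl⟩)
    · obtain ⟨h₁, h₂, h₃, h₄, h₅, h₆⟩ := h
      simp only [h₁, h₂, h₃, h₄, h₅, h₆]
      refine ⟨?_, by simp⟩
      rw [cayleyMenger]
      -- Expansion of the determinant along the first row of the Gram matrix.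
      linear_combination len 0 1 l ^ 2 * h₁ + (len 0 1 l ^ 2 + len 0 3 l ^ 2 - len 1 3 l ^ 2) / 2 * h₅
        + (len 0 1 l ^ 2 + len 0 2 l ^ 2 - len 1 2 l ^ 2) / 2 * h₄
    · rw [cayleyMenger]
      have c₁ := len_comm (1 : Fin 4) 0
      have c₂ := len_comm (2 : Fin 4) 0
      have c₃ := len_comm (3 : Fin 4) 0
      have c₄ := len_comm (2 : Fin 4) 1
      have c₅ := len_comm (3 : Fin 4) 1
      have c₆ := len_comm (3 : Fin 4) 2
      have h0 := h 0
      have h1 := h 1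
      have h2 := h 2
      have h3 := h 3
      clear h
      fin_cases i <;> fin_cases j <;>
        simp [c₁, c₂, c₃, c₄, c₅, c₆] at hij h₀ h0 h1 h2 h3 <;>
        simp only [h₀, h0, h1, h2, h3] <;>
        refine ⟨?_, ?_, ?_, ?_, ?_, ?_, ?_⟩ <;> ring
    · rw [cayleyMenger]
      have h₀₁ := hl 0 1
      have h₀₂ := hl 0 2
      have h₀₃ := hl 0 3
      have h₁₂ := hl 1 2
      have h₁₃ := hl 1 3
      have h₂₃ := hl 2 3
      clear hl
      fin_cases h <;> simp at h₀₁ h₀₂ h₀₃ h₁₂ h₁₃ h₂₃ <;>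
        simp only [h₀₁, h₀₂, h₀₃, h₁₂, h₁₃, h₂₃] <;>
        refine ⟨?_, ?_, ?_, ?_, ?_, ?_, ?_⟩ <;> ring

theorem singularLocus_unsquaredMeasurementVariety :
    singularLocus (unsquaredMeasurementVariety 2 4)
      = ⋃ W ∈ typeI ∪ typeII ∪ typeIII, (W : Set (Edge 4 → ℂ)) := by
  have hL : unsquaredMeasurementVariety 2 4 = {l | eval l cayleyMengerPoly = 0} := by
    ext l
    rw [mem_unsquaredMeasurementVariety_two_iff, ← eval_cayleyMengerPoly]
    rfl
  rw [hL, singularLocus_hypersurface irreducible_cayleyMengerPoly, Set.biUnion_union,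
    Set.biUnion_union]
  ext l
  rw [Set.mem_union, Set.mem_union, mem_iUnion_typeI, mem_iUnion_typeII, mem_iUnion_typeIII,
    or_assoc, ← cayleyMengerPoly_critical_iff, ← eval_cayleyMengerPoly]
  rfl

end Singular

/-! ### All the subspaces have dimension three. -/

section Dimensions

lemma eq_zero_of_forall_len_eq_zero {n : ℕ} {l : Edge n → ℂ} (h : ∀ i j, len i j l = 0) : l = 0 := by
  funext ⟨⟨i, j⟩, hij⟩
  exact (len_of_lt hij l).symm.trans (h i j)

/-- The vector of lengths given by a function on pairs of vertices. -/
def pairVector {n : ℕ} (F : Fin n → Fin n → ℂ) : Edge n → ℂ := fun e => F e.1.1 e.1.2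

lemma len_pairVector_of_lt {n : ℕ} (F : Fin n → Fin n → ℂ) {i j : Fin n} (hij : i < j) :
    len i j (pairVector F) = F i j :=
  len_of_lt hij _

lemma len_pairVector {n : ℕ} {F : Fin n → Fin n → ℂ} (hF : ∀ i j, F i j = F j i) {i j : Fin n}
    (hij : i ≠ j) : len i j (pairVector F) = F i j := by
  rcases lt_or_gt_of_ne hij with h | h
  · exact len_pairVector_of_lt F h
  · rw [len_comm, len_pairVector_of_lt F h, hF]

/-- A subspace on which three of the lengths are coordinates has dimension three. -/
lemma finrank_eq_three {n : ℕ} {W : Submodule ℂ (Edge n → ℂ)} (u v : Fin 3 → Fin n)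
    (hinj : ∀ l ∈ W, (∀ t, len (u t) (v t) l = 0) → l = 0)
    (hsurj : ∀ y : Fin 3 → ℂ, ∃ l ∈ W, ∀ t, len (u t) (v t) l = y t) :
    Module.finrank ℂ W = 3 := by
  let φ : W →ₗ[ℂ] (Fin 3 → ℂ) := LinearMap.pi fun t => (len (u t) (v t)).comp W.subtype
  have hφ : Function.Bijective φ := by
    constructor
    · rw [← LinearMap.ker_eq_bot, LinearMap.ker_eq_bot']
      intro l hl
      exact Subtype.ext (hinj l l.2 fun t => congrFun hl t)
    · intro y
      obtain ⟨l, hl, hy⟩ := hsurj y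
      exact ⟨⟨l, hl⟩, funext hy⟩
  rw [(LinearEquiv.ofBijective φ hφ).finrank_eq]
  simp

/-- The point of a type I subspace with given lengths of the edges at the first vertex. -/
def collinearLengths (s₁₃ s₂₃ s₁₄ s₂₄ s₃₄ : ℤˣ) (x y z : ℂ) : Edge 4 → ℂ :=
  pairVector ![![0, x, y, z], ![0, 0, s₂₃ • (s₁₃ • y - x), s₂₄ • (s₁₄ • z - x)],
    ![0, 0, 0, s₃₄ • (s₁₄ • z - s₁₃ • y)], 0]

lemma len_collinearLengths (s₁₃ s₂₃ s₁₄ s₂₄ s₃₄ : ℤˣ) (x y z : ℂ) :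
    len 0 1 (collinearLengths s₁₃ s₂₃ s₁₄ s₂₄ s₃₄ x y z) = x ∧
    len 0 2 (collinearLengths s₁₃ s₂₃ s₁₄ s₂₄ s₃₄ x y z) = y ∧
    len 0 3 (collinearLengths s₁₃ s₂₃ s₁₄ s₂₄ s₃₄ x y z) = z ∧
    len 1 2 (collinearLengths s₁₃ s₂₃ s₁₄ s₂₄ s₃₄ x y z) = s₂₃ • (s₁₃ • y - x) ∧
    len 1 3 (collinearLengths s₁₃ s₂₃ s₁₄ s₂₄ s₃₄ x y z) = s₂₄ • (s₁₄ • z - x) ∧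
    len 2 3 (collinearLengths s₁₃ s₂₃ s₁₄ s₂₄ s₃₄ x y z) = s₃₄ • (s₁₄ • z - s₁₃ • y) := by
  refine ⟨?_, ?_, ?_, ?_, ?_, ?_⟩ <;>
  · rw [collinearLengths, len_pairVector_of_lt _ (by decide)]
    rfl

lemma collinearLengths_mem (s₁₃ s₂₃ s₁₄ s₂₄ s₃₄ : ℤˣ) (x y z : ℂ) :
    collinearLengths s₁₃ s₂₃ s₁₄ s₂₄ s₃₄ x y z ∈ subspaceI s₁₃ s₂₃ s₁₄ s₂₄ s₃₄ := by
  obtain ⟨h₁, h₂, h₃, h₄, h₅, h₆⟩ := len_collinearLengths s₁₃ s₂₃ s₁₄ s₂₄ s₃₄ x y z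
  rw [mem_subspaceI, h₁, h₂, h₃, h₄, h₅, h₆, sign_smul_smul, sign_smul_smul, sign_smul_smul]
  exact ⟨by ring, by ring, by ring⟩

lemma finrank_subspaceI (s₁₃ s₂₃ s₁₄ s₂₄ s₃₄ : ℤˣ) :
    Module.finrank ℂ (subspaceI s₁₃ s₂₃ s₁₄ s₂₄ s₃₄) = 3 := by
  refine finrank_eq_three ![0, 0, 0] ![1, 2, 3] ?_ ?_
  · intro l hl h
    obtain ⟨e₁, e₂, e₃⟩ := mem_subspaceI.1 hl
    have h₁ : len 0 1 l = 0 := h 0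
    have h₂ : len 0 2 l = 0 := h 1
    have h₃ : len 0 3 l = 0 := h 2
    simp only [h₁, h₂, h₃, smul_zero, sub_zero, zero_add, smul_eq_zero_iff_eq] at e₁ e₂ e₃
    refine eq_zero_of_forall_len_eq_zero ?_
    exact forall_pair_of_edges (F := fun i j => len i j l) (G := fun _ _ => 0)
      (fun i j => by rw [len_comm]) (fun _ _ => rfl) (fun i => by simp) h₁ h₂ h₃ e₁ e₂ e₃
  · intro y
    obtain ⟨h₁, h₂, h₃, -⟩ := len_collinearLengths s₁₃ s₂₃ s₁₄ s₂₄ s₃₄ (y 0) (y 1) (y 2)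
    refine ⟨_, collinearLengths_mem _ _ _ _ _ (y 0) (y 1) (y 2), fun t => ?_⟩
    fin_cases t <;> assumption

/-- The lengths of a configuration in which the edge `ij` is collapsed, the edges at `j` have
lengths `g`, and the remaining edge has length `c`. -/
def collapsedLengths (i j : Fin 4) (s : Fin 4 → ℤˣ) (g : Fin 4 → ℂ) (c : ℂ) (x y : Fin 4) : ℂ :=
  if x = i then (if y = j then 0 else s y • g y)
  else if y = i then (if x = j then 0 else s x • g x)
  else if x = j then g y else if y = j then g x else c

lemma collapsedLengths_comm (i j : Fin 4) (s : Fin 4 → ℤˣ) (g : Fin 4 → ℂ) (c : ℂ) (x y : Fin 4) :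
    collapsedLengths i j s g c x y = collapsedLengths i j s g c y x := by
  unfold collapsedLengths
  split_ifs <;> simp_all

lemma collapsedLengths_mem {i j : Fin 4} (hij : i ≠ j) (s : Fin 4 → ℤˣ) (g : Fin 4 → ℂ) (c : ℂ) :
    pairVector (collapsedLengths i j s g c) ∈ subspaceII i j s := by
  have hlen {x y : Fin 4} := len_pairVector (collapsedLengths_comm i j s g c) (i := x) (j := y)
  rw [mem_subspaceII]
  refine ⟨by rw [hlen hij]; simp [collapsedLengths], fun k hi hj => ?_⟩
  rw [hlen hi.symm, hlen hj.symm]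
  simp [collapsedLengths, hi, hj, hij.symm]

lemma finrank_subspaceII {i j : Fin 4} (hij : i ≠ j) (s : Fin 4 → ℤˣ) :
    Module.finrank ℂ (subspaceII i j s) = 3 := by
  obtain ⟨k, m, hki, hkj, hmi, hmj, hkm, hall⟩ : ∃ k m : Fin 4, k ≠ i ∧ k ≠ j ∧ m ≠ i ∧ m ≠ j ∧
      k ≠ m ∧ ∀ x, x = i ∨ x = j ∨ x = k ∨ x = m := by
    revert i j; decide
  refine finrank_eq_three ![j, j, k] ![k, m, m] ?_ ?_
  · intro l hl h
    obtain ⟨e₀, e⟩ := mem_subspaceII.1 hl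
    have h₁ : len j k l = 0 := h 0
    have h₂ : len j m l = 0 := h 1
    have h₃ : len k m l = 0 := h 2
    have h₄ : len i k l = 0 := by rw [e k hki hkj, h₁, smul_zero]
    have h₅ : len i m l = 0 := by rw [e m hmi hmj, h₂, smul_zero]
    refine eq_zero_of_forall_len_eq_zero fun x y => ?_
    rcases hall x with rfl | rfl | rfl | rfl <;> rcases hall y with rfl | rfl | rfl | rfl <;>
      first | assumption | (rw [len_comm]; assumption) | simp
  · intro y
    let g : Fin 4 → ℂ := fun x => if x = k then y 0 else y 1
    refine ⟨_, collapsedLengths_mem hij s g (y 2), fun t => ?_⟩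
    have hlen {x z : Fin 4} :=
      len_pairVector (collapsedLengths_comm i j s g (y 2)) (i := x) (j := z)
    fin_cases t
    · refine (hlen hkj.symm).trans ?_
      simp [collapsedLengths, hki, hij.symm, g]
    · refine (hlen hmj.symm).trans ?_
      simp [collapsedLengths, hmi, hij.symm, hkm.symm, g]
    · refine (hlen hkm).trans ?_
      simp [collapsedLengths, hki, hkj, hmi, hmj]

/-- The lengths of a configuration in which the edges at `h` have lengths `g`, and the other edges
have length zero. -/
def isotropicLengths (h : Fin 4) (g : Fin 4 → ℂ) (x y : Fin 4) : ℂ :=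
  if x = h then g y else if y = h then g x else 0

lemma isotropicLengths_comm (h : Fin 4) (g : Fin 4 → ℂ) (x y : Fin 4) :
    isotropicLengths h g x y = isotropicLengths h g y x := by
  unfold isotropicLengths
  split_ifs <;> simp_all

/-- The type III subspace of the triangle opposite to the vertex `h`. -/
def oppositeSubspaceIII : Fin 4 → Submodule ℂ (Edge 4 → ℂ) :=
  ![subspaceIII 1 2 3, subspaceIII 0 2 3, subspaceIII 0 1 3, subspaceIII 0 1 2]

lemma mem_oppositeSubspaceIII {h : Fin 4} {l : Edge 4 → ℂ} :
    l ∈ oppositeSubspaceIII h ↔ ∀ i j, i ≠ h → j ≠ h → len i j l = 0 := by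
  have key : ∀ i j k, (∀ x, x ≠ h → x = i ∨ x = j ∨ x = k) → i ≠ h → j ≠ h → k ≠ h →
      (l ∈ subspaceIII i j k ↔ ∀ i j, i ≠ h → j ≠ h → len i j l = 0) := by
    intro i j k hall hi hj hk
    rw [mem_subspaceIII]
    constructor
    · rintro ⟨h₁, h₂, h₃⟩ x y hx hy
      rcases hall x hx with rfl | rfl | rfl <;> rcases hall y hy with rfl | rfl | rfl <;>
        first | assumption | (rw [len_comm]; assumption) | simp
    · intro H
      exact ⟨H _ _ hi hj, H _ _ hi hk, H _ _ hj hk⟩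
  fin_cases h <;> exact key _ _ _ (by decide) (by decide) (by decide) (by decide)

/-- Indexing by the omitted vertex replaces ordered triples, which makes the later injectivity and
counting arguments uniform. -/
lemma typeIII_eq_range : typeIII = Set.range oppositeSubspaceIII := by
  ext W
  constructor
  · rintro ⟨i, j, k, hij, hjk, rfl⟩
    obtain ⟨h, hh⟩ : ∃ h : Fin 4, (h = 0 ∧ i = 1 ∧ j = 2 ∧ k = 3) ∨ (h = 1 ∧ i = 0 ∧ j = 2 ∧ k = 3) ∨
        (h = 2 ∧ i = 0 ∧ j = 1 ∧ k = 3) ∨ (h = 3 ∧ i = 0 ∧ j = 1 ∧ k = 2) := by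
      revert i j k; decide
    refine ⟨h, ?_⟩
    rcases hh with ⟨rfl, rfl, rfl, rfl⟩ | ⟨rfl, rfl, rfl, rfl⟩ | ⟨rfl, rfl, rfl, rfl⟩ |
      ⟨rfl, rfl, rfl, rfl⟩ <;> rfl
  · rintro ⟨h, rfl⟩
    fin_cases h
    · exact ⟨1, 2, 3, by decide, by decide, rfl⟩
    · exact ⟨0, 2, 3, by decide, by decide, rfl⟩
    · exact ⟨0, 1, 3, by decide, by decide, rfl⟩
    · exact ⟨0, 1, 2, by decide, by decide, rfl⟩

lemma isotropicLengths_mem (h : Fin 4) (g : Fin 4 → ℂ) :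
    pairVector (isotropicLengths h g) ∈ oppositeSubspaceIII h := by
  rw [mem_oppositeSubspaceIII]
  intro i j hi hj
  by_cases hij : i = j
  · simp [hij]
  · rw [len_pairVector (isotropicLengths_comm h g) hij]
    simp [isotropicLengths, hi, hj]

lemma finrank_oppositeSubspaceIII (h : Fin 4) : Module.finrank ℂ (oppositeSubspaceIII h) = 3 := by
  refine finrank_eq_three (fun _ => h) (fun t => h.succAbove t) ?_ ?_
  · intro l hl h0
    rw [mem_oppositeSubspaceIII] at hl
    have hh : ∀ x, len h x l = 0 := by
      intro x
      by_cases hx : x = h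
      · simp [hx]
      · obtain ⟨t, rfl⟩ := Fin.exists_succAbove_eq hx
        exact h0 t
    refine eq_zero_of_forall_len_eq_zero fun x y => ?_
    by_cases hx : x = h
    · rw [hx, hh]
    by_cases hy : y = h
    · rw [hy, len_comm, hh]
    exact hl x y hx hy
  · intro y
    refine ⟨_, isotropicLengths_mem h (fun x => if hx : x ≠ h then
      y (Fin.exists_succAbove_eq hx).choose else 0), fun t => ?_⟩
    rw [len_pairVector (isotropicLengths_comm h _) (Fin.succAbove_ne h t).symm]
    have hne := Fin.succAbove_ne h t
    have := (Fin.exists_succAbove_eq hne).choose_spec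
    simp only [isotropicLengths, if_true, dif_pos hne]
    rw [Fin.succAbove_right_injective this]

theorem finrank_of_mem_types {W : Submodule ℂ (Edge 4 → ℂ)} (hW : W ∈ typeI ∪ typeII ∪ typeIII) :
    Module.finrank ℂ W = 3 := by
  rcases hW with (⟨_, _, _, _, _, rfl⟩ | ⟨i, j, hij, s, rfl⟩) | hW
  · exact finrank_subspaceI _ _ _ _ _
  · exact finrank_subspaceII hij.ne s
  · rw [typeIII_eq_range] at hW
    obtain ⟨h, rfl⟩ := hW
    exact finrank_oppositeSubspaceIII h

end Dimensions

/-! ### Distinctness and number of the subspaces. -/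

section Counting

lemma sign_smul_eq_iff (s t : ℤˣ) : s • (1 : ℂ) = t • 1 ↔ s = t := by
  rcases Int.units_eq_one_or s with rfl | rfl <;> rcases Int.units_eq_one_or t with rfl | rfl <;>
    simp [Units.neg_smul, neg_eq_iff_add_eq_zero, eq_neg_iff_add_eq_zero, one_add_one_eq_two]

/-- A type I subspace contains a point all of whose coordinates are nonzero, and which lies on no
other type I subspace. -/
lemma exists_generic_mem_subspaceI (s₁₃ s₂₃ s₁₄ s₂₄ s₃₄ : ℤˣ) :
    ∃ l ∈ subspaceI s₁₃ s₂₃ s₁₄ s₂₄ s₃₄, (∀ i j, i < j → len i j l ≠ 0) ∧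
      ∀ t₁₃ t₂₃ t₁₄ t₂₄ t₃₄, l ∈ subspaceI t₁₃ t₂₃ t₁₄ t₂₄ t₃₄ →
        s₁₃ = t₁₃ ∧ s₂₃ = t₂₃ ∧ s₁₄ = t₁₄ ∧ s₂₄ = t₂₄ ∧ s₃₄ = t₃₄ := by
  -- Up to sign this measures the points 0, 1, 3, 7 of a line. The nonzero lengths satisfy 1 ± 3 ± 2
  -- = 0 and 1 ± 7 ± 6 = 0 for one choice of signs only, and then 3 - 7 ± 4 = 0 fixes the last sign.
  refine ⟨_, collinearLengths_mem s₁₃ s₂₃ s₁₄ s₂₄ s₃₄ 1 (s₁₃ • 3) (s₁₄ • 7), ?_, ?_⟩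
  all_goals
    obtain ⟨h₁, h₂, h₃, h₄, h₅, h₆⟩ :=
      len_collinearLengths s₁₃ s₂₃ s₁₄ s₂₄ s₃₄ 1 (s₁₃ • 3) (s₁₄ • 7)
    rw [sign_smul_smul] at h₄ h₆
    rw [sign_smul_smul] at h₅ h₆
  · intro i j hij
    have h : (i = 0 ∧ j = 1) ∨ (i = 0 ∧ j = 2) ∨ (i = 0 ∧ j = 3) ∨ (i = 1 ∧ j = 2) ∨
        (i = 1 ∧ j = 3) ∨ (i = 2 ∧ j = 3) := by
      clear h₁ h₂ h₃ h₄ h₅ h₆; revert i j; decide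
    rcases h with ⟨rfl, rfl⟩ | ⟨rfl, rfl⟩ | ⟨rfl, rfl⟩ | ⟨rfl, rfl⟩ | ⟨rfl, rfl⟩ | ⟨rfl, rfl⟩
    · rw [h₁]; exact one_ne_zero
    · rw [h₂, Ne, smul_eq_zero_iff_eq]; norm_num
    · rw [h₃, Ne, smul_eq_zero_iff_eq]; norm_num
    · rw [h₄, Ne, smul_eq_zero_iff_eq]; norm_num
    · rw [h₅, Ne, smul_eq_zero_iff_eq]; norm_num
    · rw [h₆, Ne, smul_eq_zero_iff_eq]; norm_num
  · intro t₁₃ t₂₃ t₁₄ t₂₄ t₃₄ ht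
    obtain ⟨e₁, e₂, e₃⟩ := mem_subspaceI.1 ht
    rw [h₁, h₂, h₄] at e₁
    rw [h₁, h₃, h₅] at e₂
    rw [h₂, h₃, h₆] at e₃
    have key₁ : s₁₃ = t₁₃ ∧ s₂₃ = t₂₃ := by
      clear e₂ e₃ h₁ h₂ h₃ h₄ h₅ h₆ ht
      rcases Int.units_eq_one_or s₁₃ with rfl | rfl <;>
      rcases Int.units_eq_one_or s₂₃ with rfl | rfl <;>
      rcases Int.units_eq_one_or t₁₃ with rfl | rfl <;>
      rcases Int.units_eq_one_or t₂₃ with rfl | rfl <;>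
      first
        | exact ⟨rfl, rfl⟩
        | (exfalso; simp only [Units.neg_smul, one_smul] at e₁; norm_num at e₁)
    have key₂ : s₁₄ = t₁₄ ∧ s₂₄ = t₂₄ := by
      clear e₁ e₃ h₁ h₂ h₃ h₄ h₅ h₆ ht
      rcases Int.units_eq_one_or s₁₄ with rfl | rfl <;>
      rcases Int.units_eq_one_or s₂₄ with rfl | rfl <;>
      rcases Int.units_eq_one_or t₁₄ with rfl | rfl <;>
      rcases Int.units_eq_one_or t₂₄ with rfl | rfl <;>
      first
        | exact ⟨rfl, rfl⟩
        | (exfalso; simp only [Units.neg_smul, one_smul] at e₂; norm_num at e₂)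
    obtain ⟨rfl, rfl⟩ := key₁
    obtain ⟨rfl, rfl⟩ := key₂
    refine ⟨rfl, rfl, rfl, rfl, ?_⟩
    rw [sign_smul_smul, sign_smul_smul] at e₃
    rcases Int.units_eq_one_or s₃₄ with rfl | rfl <;>
    rcases Int.units_eq_one_or t₃₄ with rfl | rfl <;>
    first
      | rfl
      | (exfalso; simp only [Units.neg_smul, one_smul] at e₃; norm_num at e₃)

/-- A type II subspace for the edge `ij` contains a point whose only vanishing coordinate is the
one at `ij`, and which lies on no other type II subspace for this edge. -/
lemma exists_generic_mem_subspaceII {i j : Fin 4} (hij : i ≠ j) (s : Fin 4 → ℤˣ) :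
    ∃ l ∈ subspaceII i j s,
      (∀ x y, x ≠ y → len x y l = 0 → (x = i ∧ y = j) ∨ (x = j ∧ y = i)) ∧
      ∀ t, l ∈ subspaceII i j t → ∀ k, k ≠ i → k ≠ j → s k = t k := by
  have hlen {x y : Fin 4} :=
    len_pairVector (collapsedLengths_comm i j s (fun _ => 1) 1) (i := x) (j := y)
  refine ⟨_, collapsedLengths_mem hij s (fun _ => 1) 1, ?_, ?_⟩
  · intro x y hxy h
    rw [hlen hxy, collapsedLengths] at h
    split_ifs at h <;> simp_all [smul_eq_zero_iff_eq]
  · intro t ht k hi hj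
    have h := (mem_subspaceII.1 ht).2 k hi hj
    rw [hlen hi.symm, hlen hj.symm] at h
    simp only [collapsedLengths, hi, hj, hij.symm, if_true, if_false] at h
    exact (sign_smul_eq_iff _ _).1 h

/-- Vanishing coordinates separate the types: a generic point of type I has none, a generic point of
type II exactly one, whereas types II and III force at least one and three respectively. -/
theorem disjoint_typeI_typeII : Disjoint typeI typeII := by
  rw [Set.disjoint_left]
  rintro W ⟨s₁, s₂, s₃, s₄, s₅, rfl⟩ ⟨i, j, hij, t, ht⟩
  obtain ⟨l, hl, hne, -⟩ := exists_generic_mem_subspaceI s₁ s₂ s₃ s₄ s₅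
  rw [ht, mem_subspaceII] at hl
  exact hne i j hij hl.1

theorem disjoint_typeI_typeIII : Disjoint typeI typeIII := by
  rw [Set.disjoint_left]
  rintro W ⟨s₁, s₂, s₃, s₄, s₅, rfl⟩ ⟨i, j, k, hij, hjk, ht⟩
  obtain ⟨l, hl, hne, -⟩ := exists_generic_mem_subspaceI s₁ s₂ s₃ s₄ s₅
  rw [ht, mem_subspaceIII] at hl
  exact hne i j hij hl.1

theorem disjoint_typeII_typeIII : Disjoint typeII typeIII := by
  rw [Set.disjoint_left]
  rintro W ⟨i, j, hij, s, rfl⟩ ⟨a, b, c, hab, hbc, ht⟩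
  obtain ⟨l, hl, hgen, -⟩ := exists_generic_mem_subspaceII hij.ne s
  rw [ht, mem_subspaceIII] at hl
  have h₁ := hgen a b hab.ne hl.1
  have h₂ := hgen a c (hab.trans hbc).ne hl.2.1
  -- The distinct pairs ab and ac would both have to be the pair ij.
  omega

theorem ncard_typeI : typeI.ncard = 32 := by
  let F : ℤˣ × ℤˣ × ℤˣ × ℤˣ × ℤˣ → Submodule ℂ (Edge 4 → ℂ) :=
    fun s => subspaceI s.1 s.2.1 s.2.2.1 s.2.2.2.1 s.2.2.2.2
  have hF : Function.Injective F := by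
    rintro ⟨s₁, s₂, s₃, s₄, s₅⟩ ⟨t₁, t₂, t₃, t₄, t₅⟩ h
    obtain ⟨l, hl, -, hgen⟩ := exists_generic_mem_subspaceI s₁ s₂ s₃ s₄ s₅
    obtain ⟨rfl, rfl, rfl, rfl, rfl⟩ := hgen t₁ t₂ t₃ t₄ t₅ (h.le hl)
    rfl
  have hr : typeI = Set.range F := by
    ext W
    constructor
    · rintro ⟨s₁, s₂, s₃, s₄, s₅, rfl⟩
      exact ⟨(s₁, s₂, s₃, s₄, s₅), rfl⟩
    · rintro ⟨s, rfl⟩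
      exact ⟨_, _, _, _, _, rfl⟩
  rw [hr, Set.ncard_range_of_injective hF]
  simp [Nat.card_eq_fintype_card]

theorem ncard_typeIIAt {i j : Fin 4} (hij : i ≠ j) : (typeIIAt i j).ncard = 4 := by
  obtain ⟨k, m, hki, hkj, hmi, hmj, hkm, hall⟩ : ∃ k m : Fin 4, k ≠ i ∧ k ≠ j ∧ m ≠ i ∧ m ≠ j ∧
      k ≠ m ∧ ∀ x, x ≠ i → x ≠ j → x = k ∨ x = m := by
    revert i j; decide
  let F : ℤˣ × ℤˣ → Submodule ℂ (Edge 4 → ℂ) :=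
    fun s => subspaceII i j fun x => if x = k then s.1 else s.2
  have hF : Function.Injective F := by
    rintro ⟨s₁, s₂⟩ ⟨t₁, t₂⟩ h
    obtain ⟨l, hl, -, hgen⟩ :=
      exists_generic_mem_subspaceII hij fun x => if x = k then s₁ else s₂
    have := hgen (fun x => if x = k then t₁ else t₂) (h.le hl)
    have h₁ := this k hki hkj
    have h₂ := this m hmi hmj
    simp only [if_true, hkm.symm, if_false] at h₁ h₂
    rw [h₁, h₂]
  have hr : typeIIAt i j = Set.range F := by
    ext W
    constructor
    · rintro ⟨s, rfl⟩
      refine ⟨(s k, s m), ?_⟩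
      ext l
      simp only [F, mem_subspaceII]
      refine and_congr_right fun _ => forall_congr' fun x => ?_
      refine imp_congr_right fun hi => imp_congr_right fun hj => ?_
      rcases hall x hi hj with rfl | rfl
      · simp
      · simp [hkm.symm]
    · rintro ⟨s, rfl⟩
      exact ⟨_, rfl⟩
  rw [hr, Set.ncard_range_of_injective hF]
  simp [Nat.card_eq_fintype_card]

theorem ncard_typeII : typeII.ncard = 24 := by
  have hU : typeII = ⋃ e : Edge 4, typeIIAt e.1.1 e.1.2 := by
    ext W
    simp only [Set.mem_iUnion]
    constructor
    · rintro ⟨i, j, hij, hW⟩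
      exact ⟨⟨(i, j), hij⟩, hW⟩
    · rintro ⟨⟨⟨i, j⟩, hij⟩, hW⟩
      exact ⟨i, j, hij, hW⟩
  have hfin : ∀ e : Edge 4, (typeIIAt e.1.1 e.1.2).Finite := fun e =>
    Set.finite_of_ncard_ne_zero (by rw [ncard_typeIIAt e.2.ne]; norm_num)
  rw [hU, Set.ncard_iUnion_of_finite hfin]
  · rw [finsum_eq_sum_of_fintype, Finset.sum_congr rfl fun e _ => ncard_typeIIAt e.2.ne,
      Finset.sum_const, Finset.card_univ]
    have : Fintype.card (Edge 4) = 6 := by decide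
    rw [this]
    rfl
  · rintro ⟨⟨i, j⟩, hij⟩ ⟨⟨a, b⟩, hab⟩ hne
    rw [Function.onFun, Set.disjoint_left]
    rintro W ⟨s, rfl⟩ ⟨t, ht⟩
    obtain ⟨l, hl, hgen, -⟩ := exists_generic_mem_subspaceII hij.ne s
    rw [ht, mem_subspaceII] at hl
    rcases hgen a b hab.ne hl.1 with ⟨rfl, rfl⟩ | ⟨rfl, rfl⟩
    · exact hne rfl
    · exact lt_asymm hij hab

theorem ncard_typeIII : typeIII.ncard = 4 := by
  have hF : Function.Injective oppositeSubspaceIII := by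
    intro h h' heq
    by_contra hne
    -- All edges at `h` have length 1 here; one of them avoids `h'`, where the other subspace
    -- requires length 0.
    have hl := isotropicLengths_mem h fun _ => 1
    rw [heq, mem_oppositeSubspaceIII] at hl
    obtain ⟨x, hx, hx'⟩ : ∃ x : Fin 4, h ≠ x ∧ x ≠ h' := by
      clear heq hl; revert h h'; decide
    have h0 := hl h x hne hx'
    rw [len_pairVector (isotropicLengths_comm h _) hx] at h0
    simp [isotropicLengths] at h0
  rw [typeIII_eq_range, Set.ncard_range_of_injective hF]
  simp

theorem ncard_types : (typeI ∪ typeII ∪ typeIII).ncard = 60 := by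
  have h₁ : typeI.Finite := Set.finite_of_ncard_ne_zero (by rw [ncard_typeI]; norm_num)
  have h₂ : typeII.Finite := Set.finite_of_ncard_ne_zero (by rw [ncard_typeII]; norm_num)
  have h₃ : typeIII.Finite := Set.finite_of_ncard_ne_zero (by rw [ncard_typeIII]; norm_num)
  rw [Set.ncard_union_eq (Disjoint.union_left disjoint_typeI_typeIII disjoint_typeII_typeIII)
    (h₁.union h₂) h₃, Set.ncard_union_eq disjoint_typeI_typeII h₁ h₂, ncard_typeI, ncard_typeII,
    ncard_typeIII]

end Counting

theorem mainTheorem5 :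
    -- the singular locus is the union of 60 three-dimensional subspaces
    singularLocus (unsquaredMeasurementVariety 2 4)
        = (⋃ W ∈ typeI ∪ typeII ∪ typeIII, (W : Set (Edge 4 → ℂ))) ∧
      (typeI ∪ typeII ∪ typeIII).ncard = 60 ∧
      (∀ W ∈ typeI ∪ typeII ∪ typeIII, Module.finrank ℂ W = 3) ∧
      -- the three types partition these subspaces
      Disjoint typeI typeII ∧ Disjoint typeI typeIII ∧ Disjoint typeII typeIII ∧
      -- type I
      typeI.ncard = 32 ∧
      (⋃ W ∈ typeI, (W : Set (Edge 4 → ℂ))) = unsquaredMeasurementVariety 1 4 ∧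
      -- type II
      typeII.ncard = 24 ∧
      (∀ i j : Fin 4, i < j →
        (typeIIAt i j).ncard = 4 ∧
        (⋃ W ∈ typeIIAt i j, (W : Set (Edge 4 → ℂ)))
          = {l | ∃ p : Fin 4 → Fin 2 → ℂ, p i = p j ∧ squaringMap l = sqLengths p}) ∧
      -- type III
      typeIII.ncard = 4 := by
  refine ⟨singularLocus_unsquaredMeasurementVariety, ncard_types, fun W hW => finrank_of_mem_types hW,
    disjoint_typeI_typeII, disjoint_typeI_typeIII, disjoint_typeII_typeIII, ncard_typeI, ?_,
    ncard_typeII, fun i j hij => ⟨ncard_typeIIAt hij.ne, iUnion_typeIIAt_eq hij⟩, ncard_typeIII⟩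
  ext l
  exact mem_iUnion_typeI
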